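/- **Notation.** $\mathbb N=\{1,2,\dots\}$, $\mathbb Z_+=\mathbb N\cup\{0\}$, $n\in\mathbb N$, and $|\cdot|$ is the Euclidean norm. Let $E_0(t)=t$, $E_{m+1}(t)=e^{E_m(t)}$, $L_{-1}(t)=e^t$, $L_0(t)=t$, $L_{m+1}(t)=\ln L_m(t)$, and $\widehat{\mathcal L}_k=(L_{-1},L_0,\dots,L_k)$, which maps $(E_k(0),\infty)$ into $(0,\infty)^{k+2}$. For $z=(z_{-1},\dots,z_k)\in(0,\infty)^{k+2}$ and $\alpha=(\alpha_{-1},\dots,\alpha_k)\in\mathbb C^{k+2}$ put $z^\alpha=\prod_{j=-1}^k z_j^{\alpha_j}$. For integers $k\ge m\ge 0$ and $\mu\in\mathbb R$, $\mathscr P_m(k,\mu,\mathbb C^n,\mathbb R^n)$ is the set of functions $p(z)=\sum_{\alpha\in S}z^\alpha\xi_\alpha$ on $(0,\infty)^{k+2}$, where $S\subset\mathbb C^{k+2}$ is finite and closed under conjugation, $\xi_\alpha\in\mathbb C^n$, $\xi_{\bar\alpha}=\overline{\xi_\alpha}$, and $\operatorname{Re}\alpha_j=0$ for $-1\le j<m$,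 $\operatorname{Re}\alpha_m=\mu$ for all $\alpha\in S$. Further, $\mathscr F_m(k,\mu,\mathbb C^n,\mathbb R^n)=\{p\circ\widehat{\mathcal L}_k:\ p\in\mathscr P_m(k,\mu,\mathbb C^n,\mathbb R^n)\}$. For $a\le b$, functions on $(0,\infty)^{a+2}$ are regarded as functions on $(0,\infty)^{b+2}$ that depend on the first $a+2$ variables only. For $p(z)=\sum_{\alpha\in S}z^\alpha\xi_\alpha$ on $(0,\infty)^{k+2}$ put $$\mathcal M_jp(z)=\sum_{\alpha\in S}\alpha_jz^\alpha\xi_\alpha,\qquad \mathcal Rp(z)=\sum_{j=0}^k z_0^{-1}z_1^{-1}\cdots z_j^{-1}\mathcal M_jp(z),\qquad \mathcal Z_Ap(z)=\sum_{\alpha\in S}z^\alpha(A+\alpha_{-1}I_n)^{-1}\xi_\alpha,$$ the last one when $\operatorname{Re}\alpha_{-1}=0$ for all $\alpha\in S$. For $m\in\mathbb Z_+$ and a strictly increasing sequence $(\mu_k)$ of positive numbers with $\mu_k\to\infty$, we write $g(t)\sim\sum_{k=1}^\infty g_k(t)$ at level $m$ if for every $N\in\mathbb N$ there is $\mu>\mu_N$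 with $\left|g(t)-\sum_{k=1}^N g_k(t)\right|=\mathcal O(L_m(t)^{-\mu})$ as $t\to\infty$. **Assumptions.** Consider $y'=-Ay+G(y)+f(t)$ in $\mathbb R^n$, where: * $A$ is a real $n\times n$ matrix all of whose eigenvalues have positive real parts; * $G:\mathbb R^n\to\mathbb R^n$ is locally Lipschitz, and there are homogeneous polynomial maps $G_m:\mathbb R^n\to\mathbb R^n$ of degree $m$, $m\ge2$, such that for every $N\ge2$ there is $\delta>0$ with $\left|G(x)-\sum_{m=2}^NG_m(x)\right|=\mathcal O(|x|^{N+\delta})$ as $x\to0$; * $f$ is $\mathbb R^n$-valued and continuous on $[T_f,\infty)$ for some $T_f\ge0$; * $y\in C^1((T_0,\infty),\mathbb R^n)$, for some $T_0\ge0$, is a solution on $(T_0,\infty)$ with $y(t)\to0$ as $t\to\infty$. For $m\ge2$ let $\mathcal G_m:(\mathbb R^n)^m\to\mathbb R^n$ be any $m$-linear maps with $G_m(x)=\mathcal G_m(x,\dots,x)$; their $\mathbb C$-multilinear extensions to $(\mathbb C^n)^m$ are denoted by the same symbols. Let $(\mu_k)_{k\ge1}$ be a strictly increasing sequence of positive numbers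 with $\mu_k\to\infty$, such that $\mathcal S=\{\mu_k:k\in\mathbb N\}$ is closed under addition, and let $(n_k)_{k\ge1}$ be a nondecreasing sequence in $\mathbb Z_+$. **Theorem.** (i) (*Power decay.*) Assume moreover that $x+1\in\mathcal S$ for all $x\in\mathcal S$, and that $f(t)\sim\sum_{k=1}^\infty f_k(t)$ at level $0$ with $f_k\in\mathscr F_0(n_k,-\mu_k,\mathbb C^n,\mathbb R^n)$. Then there are functions $y_k\in\mathscr F_0(n_k,-\mu_k,\mathbb C^n,\mathbb R^n)$, which are therefore $\mathbb R^n$-valued, such that $y(t)\sim\sum_{k=1}^\infty y_k(t)$ at level $0$. More specifically, if $f_k=p_k\circ\widehat{\mathcal L}_{n_k}$ with $p_k\in\mathscr P_0(n_k,-\mu_k,\mathbb C^n,\mathbb R^n)$ for all $k$, then the recursion $$q_k=\mathcal Z_A\Big(\sum_{r\ge2}\ \sum_{\mu_{j_1}+\dots+\mu_{j_r}=\mu_k}\mathcal G_r(q_{j_1},\dots,q_{j_r})+p_k-\chi_k\Big),\qquad k\in\mathbb N,$$ with $\chi_k=\mathcal Rq_\lambda$ if there is $\lambda\le k-1$ with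 $\mu_\lambda+1=\mu_k$, and $\chi_k=0$ otherwise, determines unique functions $q_k$; they belong to $\mathscr P_0(n_k,-\mu_k,\mathbb C^n,\mathbb R^n)$, are $\mathbb R^n$-valued, and $y(t)\sim\sum_{k=1}^\infty q_k(\widehat{\mathcal L}_{n_k}(t))$ at level $0$. (ii) (*Logarithmic and iterated logarithmic decay.*) Let $m_*\in\mathbb N$ and assume that $n_k\ge m_*$ for all $k$ and that $f(t)\sim\sum_{k=1}^\infty f_k(t)$ at level $m_*$ with $f_k\in\mathscr F_{m_*}(n_k,-\mu_k,\mathbb C^n,\mathbb R^n)$. Then there are functions $y_k\in\mathscr F_{m_*}(n_k,-\mu_k,\mathbb C^n,\mathbb R^n)$, which are therefore $\mathbb R^n$-valued, such that $y(t)\sim\sum_{k=1}^\infty y_k(t)$ at level $m_*$. More specifically, if $f_k=p_k\circ\widehat{\mathcal L}_{n_k}$ with $p_k\in\mathscr P_{m_*}(n_k,-\mu_k,\mathbb C^n,\mathbb R^n)$ for all $k$, then the recursion $$q_k=\mathcal Z_A\Big(\sum_{r\ge2}\ \sum_{\mu_{j_1}+\dots+\mu_{j_r}=\mu_k}\mathcal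 G_r(q_{j_1},\dots,q_{j_r})+p_k\Big),\qquad k\in\mathbb N,$$ determines unique functions $q_k$; they belong to $\mathscr P_{m_*}(n_k,-\mu_k,\mathbb C^n,\mathbb R^n)$, are $\mathbb R^n$-valued, and $y(t)\sim\sum_{k=1}^\infty q_k(\widehat{\mathcal L}_{n_k}(t))$ at level $m_*$. -/

import Mathlib

open Filter Topology Asymptotics Set

/-- The Euclidean space `ℝⁿ`. -/
abbrev RVec (n : ℕ) := EuclideanSpace ℝ (Fin n)

/-- The Euclidean space `ℂⁿ`, which is the complexification of `ℝⁿ`. -/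
abbrev CVec (n : ℕ) := EuclideanSpace ℂ (Fin n)

/-- The inclusion `ℝⁿ ⊂ ℂⁿ`. -/
noncomputable def toC {n : ℕ} (x : RVec n) : CVec n := WithLp.toLp 2 fun i => (x i : ℂ)

/-- The conjugation of `ℂⁿ`. -/
noncomputable def conjVec {n : ℕ} (v : CVec n) : CVec n :=
  WithLp.toLp 2 fun i => (starRingEnd ℂ) (v i)

/-- The vector `v ∈ ℂⁿ` belongs to `ℝⁿ`. -/
def IsRealVec {n : ℕ} (v : CVec n) : Prop := ∃ x : RVec n, v = toC x

/-! ### Iterated exponentials and logarithms -/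

/-- `E_0(t) = t`, `E_{m+1}(t) = exp (E_m(t))`. -/
noncomputable def iterExp : ℕ → ℝ → ℝ
  | 0, t => t
  | m + 1, t => Real.exp (iterExp m t)

/-- `L_0(t) = t`, `L_{m+1}(t) = ln (L_m(t))` (meaningful for `t > E_m(0)`). -/
noncomputable def iterLog : ℕ → ℝ → ℝ
  | 0, t => t
  | m + 1, t => Real.log (iterLog m t)

theorem iterExp_succ' (m : ℕ) (s : ℝ) : iterExp (m + 1) s = iterExp m (Real.exp s) := by
  induction m with
  | zero => rfl
  | succ m ih => exact congrArg Real.exp ih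

theorem iterExp_mono {j k : ℕ} (h : j ≤ k) (s : ℝ) : iterExp j s ≤ iterExp k s := by
  induction k, h using Nat.le_induction with
  | base => exact le_rfl
  | succ k _ ih =>
    refine ih.trans ?_
    change iterExp k s ≤ Real.exp (iterExp k s)
    linarith [Real.add_one_le_exp (iterExp k s)]

theorem lt_iterLog (j : ℕ) (s t : ℝ) (h : iterExp j s < t) : s < iterLog j t := by
  induction j generalizing s with
  | zero => exact h
  | succ j ih =>
    rw [iterExp_succ'] at h
    have h1 := ih _ h
    exact (Real.lt_log_iff_exp_lt ((Real.exp_pos s).trans h1)).2 h1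

/-! ### Power functions of several variables

Vectors `z = (z_{-1}, z_0, …, z_k)` and `α = (α_{-1}, α_0, …, α_k)` are indexed by `Fin (k + 2)`:
the subscript `j` is the index `j + 1`. -/

/-- `(0,∞)^{k+2}`. -/
abbrev PosVec (k : ℕ) := Fin (k + 2) → {x : ℝ // 0 < x}

/-- `L_{-1}(t), L_0(t), L_1(t), …`, where `L_{-1}(t) = e^t`. -/
noncomputable def lseq (t : ℝ) : ℕ → ℝ
  | 0 => Real.exp t
  | j + 1 => iterLog j t

theorem lseq_pos {k : ℕ} {t : ℝ} (ht : iterExp k 0 < t) (i : Fin (k + 2)) : 0 < lseq t i := by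
  obtain ⟨i, hi⟩ := i
  cases i with
  | zero => exact Real.exp_pos t
  | succ j => exact lt_iterLog j 0 t ((iterExp_mono (by omega) 0).trans_lt ht)

/-- `(L_{-1}(t), L_0(t), …, L_k(t)) ∈ (0,∞)^{k+2}` for `t > E_k(0)`. -/
noncomputable def lhat (k : ℕ) (t : ℝ) (ht : iterExp k 0 < t) : PosVec k :=
  fun i => ⟨lseq t i, lseq_pos ht i⟩

/-- `z^α = ∏_j z_j^{α_j}`. -/
noncomputable def vecPow {k : ℕ} (z : PosVec k) (α : Fin (k + 2) → ℂ) : ℂ :=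
  ∏ i, (((z i : ℝ) : ℂ) ^ α i)

/-- The function `z ↦ ∑_α z^α ξ_α`, for a finite family of coefficients `ξ_α ∈ ℂⁿ`. -/
noncomputable def powerSum {n k : ℕ} (ξ : (Fin (k + 2) → ℂ) →₀ CVec n) : PosVec k → CVec n :=
  fun z => ξ.sum fun α v => vecPow z α • v

/-- `z ↦ z^α` as a homomorphism of the multiplicative group `(0,∞)^{k+2}`. -/
noncomputable def vecPowHom {k : ℕ} (α : Fin (k + 2) → ℂ) : PosVec k →* ℂ where
  toFun z := vecPow z α
  map_one' := by simp [vecPow]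
  map_mul' z w := by
    simp only [vecPow, Pi.mul_apply, Positive.val_mul, Complex.ofReal_mul,
      ← Finset.prod_mul_distrib]
    exact Finset.prod_congr rfl fun i _ =>
      Complex.mul_cpow_ofReal_nonneg (z i).2.le (w i).2.le (α i)

theorem vecPowHom_injective {k : ℕ} :
    Function.Injective (vecPowHom : (Fin (k + 2) → ℂ) → (PosVec k →* ℂ)) := by
  intro α β h
  funext i
  have key : ∀ γ : Fin (k + 2) → ℂ, ∀ t : ℝ,
      vecPowHom γ (Function.update 1 i ⟨Real.exp t, Real.exp_pos t⟩) = Complex.exp (t * γ i) := by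
    intro γ t
    change vecPow _ γ = _
    unfold vecPow
    rw [Finset.prod_eq_single i]
    · rw [Function.update_self, Complex.cpow_def_of_ne_zero
        (by exact_mod_cast (Real.exp_pos t).ne'), ← Complex.ofReal_log (Real.exp_pos t).le,
        Real.log_exp]
    · intro j _ hj
      rw [Function.update_of_ne hj]
      simp
    · simp
  have h1 : (fun t : ℝ => Complex.exp (t * α i)) = fun t : ℝ => Complex.exp (t * β i) := by
    funext t
    rw [← key α, ← key β, h]
  have hd : ∀ c : ℂ, HasDerivAt (fun t : ℝ => Complex.exp (t * c)) c 0 := by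
    intro c
    have h2 : HasDerivAt (fun t : ℝ => (t : ℂ) * c) (1 * c) 0 :=
      (Complex.ofRealCLM.hasDerivAt (x := (0 : ℝ))).mul_const c
    simpa using h2.cexp
  exact (hd (α i)).unique (h1 ▸ hd (β i))

/-- The coefficients of `∑_α z^α ξ_α` are determined by the function. -/
theorem powerSum_injective {n k : ℕ} :
    Function.Injective (powerSum : ((Fin (k + 2) → ℂ) →₀ CVec n) → PosVec k → CVec n) := by
  have hli : LinearIndependent ℂ (fun α : Fin (k + 2) → ℂ => ((vecPowHom α : PosVec k →* ℂ) :
      PosVec k → ℂ)) :=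
    (linearIndependent_monoidHom (PosVec k) ℂ).comp _ vecPowHom_injective
  intro ξ η h
  ext α i
  have h0 : (fun v : CVec n => v i) 0 = 0 := by simp
  have hc : ∀ ζ : (Fin (k + 2) → ℂ) →₀ CVec n,
      Finsupp.linearCombination ℂ (fun α : Fin (k + 2) → ℂ =>
        ((vecPowHom α : PosVec k →* ℂ) : PosVec k → ℂ))
        (ζ.mapRange (fun v : CVec n => v i) h0) = fun z => powerSum ζ z i := by
    intro ζ
    funext z
    rw [Finsupp.linearCombination_apply, Finsupp.sum_mapRange_index (by simp)]
    simp only [powerSum, Finsupp.sum, Finset.sum_apply, WithLp.ofLp_sum, Pi.smul_apply,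
      WithLp.ofLp_smul, smul_eq_mul]
    exact Finset.sum_congr rfl fun a _ => mul_comm _ _
  have h2 : ξ.mapRange (fun v : CVec n => v i) h0 = η.mapRange (fun v : CVec n => v i) h0 :=
    hli ((hc ξ).trans ((by rw [h] : _ = _).trans (hc η).symm))
  exact DFunLike.congr_fun h2 α

/-- The coefficients `(ξ_α)` of a function `p(z) = ∑_α z^α ξ_α`. -/
noncomputable def coeffs {n k : ℕ} (p : PosVec k → CVec n) : (Fin (k + 2) → ℂ) →₀ CVec n :=
  Function.invFun powerSum p

theorem coeffs_powerSum {n k : ℕ} (ξ : (Fin (k + 2) → ℂ) →₀ CVec n) :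
    coeffs (powerSum ξ) = ξ :=
  Function.leftInverse_invFun powerSum_injective ξ

/-- `ℰ(m,k,μ)`: the exponents with `Re α_j = 0` for `-1 ≤ j < m` and `Re α_m = μ`. -/
def expSet (m k : ℕ) (μ : ℝ) : Set (Fin (k + 2) → ℂ) :=
  {α | ∀ i : Fin (k + 2), ((i : ℕ) < m + 1 → (α i).re = 0) ∧ ((i : ℕ) = m + 1 → (α i).re = μ)}

/-- `𝒫_m(k,μ,ℂⁿ,ℝⁿ)`: finite sums `∑_α z^α ξ_α` with all `α ∈ ℰ(m,k,μ)` and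
`ξ_{conj α} = conj ξ_α` (the set of exponents is then closed under conjugation). -/
def ClassP (n m k : ℕ) (μ : ℝ) : Set (PosVec k → CVec n) :=
  {p | ∃ ξ : (Fin (k + 2) → ℂ) →₀ CVec n,
    (∀ α ∈ ξ.support, α ∈ expSet m k μ) ∧ (∀ α, ξ (star α) = conjVec (ξ α)) ∧ p = powerSum ξ}

/-- The function `t ↦ p(L_{-1}(t), …, L_k(t))`, for `t > E_k(0)` (extended by zero). -/
noncomputable def compL {n k : ℕ} (p : PosVec k → CVec n) (t : ℝ) : CVec n :=
  open Classical in if ht : iterExp k 0 < t then p (lhat k t ht) else 0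

/-- `ℱ_m(k,μ,ℂⁿ,ℝⁿ)`: the functions on `(E_k(0),∞)` that are compositions of the members of
`𝒫_m(k,μ,ℂⁿ,ℝⁿ)` with `(L_{-1}, …, L_k)`. -/
def ClassF (n m k : ℕ) (μ : ℝ) : Set (ℝ → CVec n) :=
  {g | ∃ p ∈ ClassP n m k μ, EqOn g (compL p) (Ioi (iterExp k 0))}

/-- The expansion `g(t) ∼ ∑_k g_k(t)`, where `g_k` has the order `L_m(t)^{-γ_k}`; the sequences
start with the index `0`. -/
def LExpansion {n : ℕ} (m : ℕ) (γ : ℕ → ℝ) (g : ℝ → CVec n) (gk : ℕ → ℝ → CVec n) : Prop :=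
  ∀ N : ℕ, ∃ μ : ℝ, γ N < μ ∧
    (fun t => g t - ∑ k ∈ Finset.range (N + 1), gk k t) =O[atTop] fun t => iterLog m t ^ (-μ)

/-! ### The operators `ℳ_j`, `ℛ` and `𝒵_A` -/

/-- `(ℳ_j p)(z) = ∑_α α_j z^α ξ_α`. -/
noncomputable def opM {n k : ℕ} (i : Fin (k + 2)) (p : PosVec k → CVec n) : PosVec k → CVec n :=
  fun z => (coeffs p).sum fun α v => (α i * vecPow z α) • v

/-- `(ℛ p)(z) = ∑_{j=0}^k z_0⁻¹ z_1⁻¹ ⋯ z_j⁻¹ (ℳ_j p)(z)`. -/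
noncomputable def opR {n k : ℕ} (p : PosVec k → CVec n) : PosVec k → CVec n :=
  fun z => ∑ j : Fin (k + 1),
    (∏ i ∈ Finset.Iic j, (((z i.succ : ℝ) : ℂ))⁻¹) • opM j.succ p z

/-- `(𝒵_A p)(z) = ∑_α z^α (A + α_{-1} I)⁻¹ ξ_α`. -/
noncomputable def opZ {n k : ℕ} (A : Matrix (Fin n) (Fin n) ℂ) (p : PosVec k → CVec n) :
    PosVec k → CVec n :=
  fun z => (coeffs p).sum fun α v =>
    vecPow z α • Matrix.toEuclideanLin ((A + α 0 • (1 : Matrix (Fin n) (Fin n) ℂ))⁻¹) v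

/-! ### The nonlinearity -/

/-- `F : ℝⁿ → ℝⁿ` is a homogeneous polynomial map of degree `m`. -/
def IsHomogPolyMap {n : ℕ} (m : ℕ) (F : RVec n → RVec n) : Prop :=
  ∀ i, ∃ P : MvPolynomial (Fin n) ℝ, P.IsHomogeneous m ∧
    ∀ x : RVec n, F x i = MvPolynomial.eval (fun j => x j) P

/-- The complexification of an `m`-linear map `(ℝⁿ)^m → ℝⁿ`. -/
noncomputable def complexify {n m : ℕ} (M : MultilinearMap ℝ (fun _ : Fin m => RVec n) (RVec n))
    (z : Fin m → CVec n) : CVec n :=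
  ∑ J : Fin m → Fin n, (∏ i, z i (J i)) • toC (M fun i => EuclideanSpace.single (J i) 1)

/-- The embedding of the functions on `(0,∞)^{a+2}` into those on `(0,∞)^{b+2}`, for `a ≤ b`:
the function depends on the first `a + 2` variables only. -/
noncomputable def embedP {n : ℕ} (a b : ℕ) (p : PosVec a → CVec n) : PosVec b → CVec n :=
  fun z => p fun i => if h : (i : ℕ) < b + 2 then z ⟨i, h⟩ else 1

/-- All `(m; j_1, …, j_m)` with `m ≥ 2` and `μ_{j_1} + ⋯ + μ_{j_m} = μ_k`. -/
def tupleSet (μ : ℕ → ℝ) (k : ℕ) : Set (Σ m : ℕ, (Fin m → ℕ)) :=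
  {J | 2 ≤ J.1 ∧ ∑ i, μ (J.2 i) = μ k}

/-- `∑_{m ≥ 2} ∑_{μ_{j_1} + ⋯ + μ_{j_m} = μ_k} 𝒢_m(q_{j_1}, …, q_{j_m})`, a finite sum if the `μ_j`
are positive and increase to infinity; `𝒢_m` is complexified, as the `q_j` take values in `ℂⁿ`. -/
noncomputable def nonlinTerm {n : ℕ}
    (𝒢 : (m : ℕ) → MultilinearMap ℝ (fun _ : Fin m => RVec n) (RVec n))
    (μ : ℕ → ℝ) (ν : ℕ → ℕ) (q : (k : ℕ) → PosVec (ν k) → CVec n) (k : ℕ) :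
    PosVec (ν k) → CVec n :=
  fun z => ∑ᶠ J ∈ tupleSet μ k,
    complexify (𝒢 J.1) fun i => embedP (ν (J.2 i)) (ν k) (q (J.2 i)) z

/-- `χ_k = ℛ q_l` if there is `l < k` with `μ_l + 1 = μ_k`, and `χ_k = 0` otherwise. -/
noncomputable def chiTerm {n : ℕ} (μ : ℕ → ℝ) (ν : ℕ → ℕ)
    (q : (k : ℕ) → PosVec (ν k) → CVec n) (k : ℕ) : PosVec (ν k) → CVec n :=
  open Classical in
  if h : ∃ l, l < k ∧ μ l + 1 = μ k then embedP (ν h.choose) (ν k) (opR (q h.choose)) else 0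

/-- The complexification extends the given map, so it may be replaced by that map wherever the
arguments are real. -/
theorem complexify_toC {n m : ℕ} (M : MultilinearMap ℝ (fun _ : Fin m => RVec n) (RVec n))
    (x : Fin m → RVec n) : complexify M (fun i => toC (x i)) = toC (M x) := by
  have hx : x = fun i => ∑ j, x i j • (EuclideanSpace.single j (1 : ℝ) : RVec n) := by
    funext i
    ext l
    simp [Finset.sum_apply, Pi.single_apply]
  conv_rhs => rw [hx, MultilinearMap.map_sum]
  ext l
  simp only [MultilinearMap.map_smul_univ]
  simp [complexify, toC]

/-! ### Recursions and multilinear maps -/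

/-! Formal side. Along `(L_{-1}, …, L_k)` the derivative of `p` is `ℳ_{-1} p + ℛ p`
(`hasDerivAt_compL`): the exponent of `e^t` is differentiated without gain, every other exponent
gains at least a factor `1/t`. Matching terms of order `L_m^{-μ_k}` therefore leaves the linear
equation `(A + ℳ_{-1}) q_k =` known terms. It is solved by `𝒵_A` (`opZ_equation`), because `α_{-1}`
is purely imaginary while the spectrum of `A` lies in the open right half-plane. For `m = 0`, `ℛ
q_λ` has order `t^{-μ_λ-1}` and reappears as `χ_k` at a later index; for `m ≥ 1` it is smaller than
every power of `L_m` and drops out. Since `𝒮` is closed under addition, each product of terms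
belongs to exactly one index. Hence a partial sum `s` of the formal solution solves the equation,
with `G` replaced by a Taylor polynomial, up to a remainder that decays faster than `L_m^{-μ_N}`
(`exists_residual`).

Analytic side. If `w' = -Aw + h` with `|h| ≤ ε|w| + O(L_m^{-μ})` and `ε` small, then `w =
O(L_m^{-μ})` (`exists_stability_iterLog`): `exp(-tA)` decays exponentially, whereas `L_m^{-μ}`
varies more slowly than any exponential. This is used twice. Applied to `y` it gives an a priori
rate (`solution_isBigO`), which makes the Taylor remainder of `G` at `y` negligible once the degree
is large. Applied to `w = y - s` it gives the expansion (`lExpansion_solution`), since the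
polynomial part has an arbitrarily small Lipschitz constant near `0`. No induction on `N` is needed
in the estimates.

Both statements are instances of `expansion_of_recursion`, whose correction term `X` is `χ` or `0`.
-/

theorem existsUnique_of_causal {β : ℕ → Type*} [∀ k, Inhabited (β k)]
    (F : (∀ k, β k) → ∀ k, β k)
    (hF : ∀ k q q', (∀ j < k, q j = q' j) → F q k = F q' k) : ∃! q, ∀ k, q k = F q k := by
  classical
  -- Entries not yet constructed are filled with `default`; by `hF` they do not influence the value
  -- at `k`.
  let q : ∀ k, β k := fun k => Nat.strongRecOn (motive := β) k fun k ih =>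
    F (fun j => if h : j < k then ih j h else default) k
  have hq : ∀ k, q k = F q k := by
    intro k
    have h1 : q k = F (fun j => if j < k then q j else default) k := by
      change Nat.strongRecOn (motive := β) k _ = _
      rw [Nat.strongRecOn_eq]
      simp only [dite_eq_ite]
      rfl
    rw [h1]
    exact hF k _ _ fun j hj => if_pos hj
  refine ⟨q, hq, fun q' hq' => ?_⟩
  funext k
  induction k using Nat.strong_induction_on with
  | _ k ih => rw [hq' k, hq k]; exact hF k _ _ ih

/-- List the variables of the monomial with multiplicity and let the `i`-th factor read the `i`-th
argument. The map is not symmetric, and symmetry is not required of `𝒢`. -/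
theorem exists_multilinear_of_monomial {n m : ℕ} (d : Fin n →₀ ℕ) (hd : d.degree = m) :
    ∃ M : MultilinearMap ℝ (fun _ : Fin m => RVec n) ℝ,
      ∀ x : RVec n, (M fun _ => x) = ∏ i, x i ^ d i := by
  subst hd
  have hcard : d.toMultiset.toList.length = d.degree := by
    rw [Multiset.length_toList, Finsupp.card_toMultiset, Finsupp.degree_eq_sum,
      Finsupp.sum_fintype _ _ fun _ => rfl]
    simp
  refine ⟨(MultilinearMap.mkPiAlgebra ℝ (Fin d.degree) ℝ).compLinearMap fun i =>
    (EuclideanSpace.proj (d.toMultiset.toList.get (Fin.cast hcard.symm i)) :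
      RVec n →L[ℝ] ℝ).toLinearMap, fun x => ?_⟩
  have h1 : ∏ i : Fin d.degree, x (d.toMultiset.toList.get (Fin.cast hcard.symm i)) =
      ∏ i : Fin d.toMultiset.toList.length, x (d.toMultiset.toList.get i) :=
    Fintype.prod_equiv (finCongr hcard.symm) _ _ fun i => rfl
  have h2 : ∏ i : Fin d.toMultiset.toList.length, x (d.toMultiset.toList.get i) =
      (d.toMultiset.toList.map x).prod := by
    rw [← List.prod_ofFn]
    congr 1
    conv_rhs => rw [← List.ofFn_get d.toMultiset.toList, List.map_ofFn]
    rfl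
  simp only [MultilinearMap.compLinearMap_apply, MultilinearMap.mkPiAlgebra_apply]
  refine (h1.trans h2).trans ?_
  rw [← Multiset.prod_coe, ← Multiset.map_coe, Multiset.coe_toList, Finsupp.toMultiset_map,
    Finsupp.prod_toMultiset, Finsupp.prod_mapDomain_index (by simp) (by intros; rw [pow_add]),
    Finsupp.prod_fintype _ _ (by simp)]

theorem IsHomogPolyMap.exists_multilinear {n m : ℕ} {F : RVec n → RVec n}
    (hF : IsHomogPolyMap m F) :
    ∃ M : MultilinearMap ℝ (fun _ : Fin m => RVec n) (RVec n), ∀ x, F x = M fun _ => x := by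
  classical
  choose P hP hPF using hF
  have h : ∀ i, ∃ M : MultilinearMap ℝ (fun _ : Fin m => RVec n) ℝ,
      ∀ x : RVec n, (M fun _ => x) = MvPolynomial.eval (fun j => x j) (P i) := by
    intro i
    have h1 : ∀ d : (P i).support, ∃ M : MultilinearMap ℝ (fun _ : Fin m => RVec n) ℝ,
      ∀ x : RVec n, (M fun _ => x) = ∏ i, x i ^ d.1 i := fun d =>
        exists_multilinear_of_monomial d.1 (by
          have := hP i (MvPolynomial.mem_support_iff.1 d.2)
          rw [Finsupp.degree_eq_weight_one]; exact this)
    choose M hM using h1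
    refine ⟨∑ d, (P i).coeff d.1 • M d, fun x => ?_⟩
    rw [MvPolynomial.eval_eq', ← Finset.sum_coe_sort (P i).support]
    simp [hM]
  choose M hM using h
  refine ⟨((EuclideanSpace.equiv (Fin n) ℝ).symm.toLinearMap).compMultilinearMap
    (MultilinearMap.pi M), fun x => ?_⟩
  ext i
  simp [hPF, hM]

/-! ### Exponential decay and stability -/

section Stability

variable {E : Type*} [NormedAddCommGroup E] [NormedSpace ℂ E] [FiniteDimensional ℂ E]


theorem exp_apply_of_eigenvector (B : E →L[ℂ] E) (v : E) (c : ℂ)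
    (h : B v = c • v) : NormedSpace.exp B v = Complex.exp c • v := by
  have h1 := (ContinuousLinearMap.apply ℂ (E) v).hasSum
    (NormedSpace.exp_series_hasSum_exp' (𝕂 := ℂ) B)
  have h2 := (NormedSpace.exp_series_hasSum_exp' (𝕂 := ℂ) c).smul_const v
  rw [← Complex.exp_eq_exp_ℂ] at h2
  refine h1.unique ?_
  convert h2 using 1
  funext k
  have : ∀ k : ℕ, (B ^ k) v = c ^ k • v := by
    intro k
    induction k with
    | zero => simp
    | succ k ih => rw [pow_succ', mul_apply_eq_comp, ih, map_smul, h, smul_smul, pow_succ]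
  simp [this, smul_smul]

/-- The needed half of the spectral mapping theorem: `B` commutes with `exp(-B)`, so it preserves
the `z`-eigenspace and has an eigenvector there, with eigenvalue `c`; then `z = e^{-c}`. -/
theorem spectrum_exp_neg_lt_one (B : E →L[ℂ] E)
    (hB : ∀ l ∈ spectrum ℂ B, 0 < l.re) (z : ℂ) (hz : z ∈ spectrum ℂ (NormedSpace.exp (-B))) :
    ‖z‖ < 1 := by
  set X := NormedSpace.exp (-B) with hX
  have hz' : Module.End.HasEigenvalue (X : Module.End ℂ (E)) z := by
    rw [Module.End.hasEigenvalue_iff_mem_spectrum,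
      ← AlgEquiv.spectrum_eq (Module.End.toContinuousLinearMap (𝕜 := ℂ) (E))]
    exact hz
  have : CompleteSpace E := FiniteDimensional.complete ℂ E
  have hcomm : Commute X B := by
    rw [hX]
    exact ((Commute.refl B).neg_left).exp_left
  set V := Module.End.eigenspace (X : Module.End ℂ (E)) z with hV
  have hmap : ∀ x ∈ V, (B : Module.End ℂ (E)) x ∈ V := by
    intro x hx
    rw [hV, Module.End.mem_eigenspace_iff] at hx ⊢
    have h1 : X (B x) = B (X x) := DFunLike.congr_fun hcomm.eq x
    change X (B x) = z • B x
    rw [h1]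
    change X x = z • x at hx
    rw [hx, map_smul]
  have : Nontrivial V := Submodule.nontrivial_iff_ne_bot.2 hz'
  obtain ⟨c, hc⟩ := Module.End.exists_eigenvalue ((B : Module.End ℂ (E)).restrict hmap)
  obtain ⟨v, hv⟩ := hc.exists_hasEigenvector
  have hv1 : B (v : E) = c • (v : E) := congrArg Subtype.val hv.apply_eq_smul
  have hv0 : (v : E) ≠ 0 := fun h => hv.2 (Subtype.ext h)
  have hcs : c ∈ spectrum ℂ B := by
    have : Module.End.HasEigenvalue (B : Module.End ℂ (E)) c :=
      Module.End.hasEigenvalue_of_hasEigenvector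
        (x := (v : E)) ⟨Module.End.mem_eigenspace_iff.2 hv1, hv0⟩
    rw [Module.End.hasEigenvalue_iff_mem_spectrum,
      ← AlgEquiv.spectrum_eq (Module.End.toContinuousLinearMap (𝕜 := ℂ) (E))] at this
    exact this
  have hXv : X (v : E) = z • (v : E) := Module.End.mem_eigenspace_iff.1 v.2
  have hXv' : X (v : E) = Complex.exp (-c) • (v : E) := by
    refine exp_apply_of_eigenvector (-B) _ _ ?_
    simp [hv1]
  have hzc : z = Complex.exp (-c) := smul_left_injective ℂ hv0 (hXv.symm.trans hXv')
  rw [hzc, Complex.norm_exp]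
  have := hB c hcs
  simpa using this

theorem exists_norm_exp_pow_lt_one [Nontrivial E] (B : E →L[ℂ] E)
    (hB : ∀ l ∈ spectrum ℂ B, 0 < l.re) :
    ∃ k : ℕ, 1 ≤ k ∧ ‖NormedSpace.exp (-B) ^ k‖ < 1 := by
  obtain ⟨z, hz, hzr⟩ := spectrum.exists_nnnorm_eq_spectralRadius (NormedSpace.exp (-B))
  have h1 := spectrum_exp_neg_lt_one B hB z hz
  have h2 : spectralRadius ℂ (NormedSpace.exp (-B)) < 1 := by
    rw [← hzr]
    exact_mod_cast h1
  -- Gelfand's formula: `‖X^k‖^{1/k}` tends to the spectral radius, which is less than `1`.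
  have h3 := (spectrum.pow_nnnorm_pow_one_div_tendsto_nhds_spectralRadius
    (NormedSpace.exp (-B))).eventually (gt_mem_nhds h2)
  obtain ⟨k, hk1, hk⟩ := ((eventually_ge_atTop 1).and h3).exists
  refine ⟨k, hk1, ?_⟩
  by_contra hcon
  push Not at hcon
  have : (1 : ENNReal) ≤ (‖NormedSpace.exp (-B) ^ k‖₊ : ENNReal) := by exact_mod_cast hcon
  exact absurd hk (not_lt.2 (ENNReal.one_le_rpow this (by positivity)))

theorem exp_smul_add (B : E →L[ℂ] E) (s t : ℂ) :
    NormedSpace.exp ((s + t) • B) = NormedSpace.exp (s • B) * NormedSpace.exp (t • B) := by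
  let _ : NormedAlgebra ℚ (E →L[ℂ] E) := NormedAlgebra.restrictScalars ℚ ℂ _
  rw [add_smul]
  exact NormedSpace.exp_add_of_commute (((Commute.refl B).smul_left s).smul_right t)

theorem exp_nsmul_eq_pow (B : E →L[ℂ] E) (s : ℂ) (k : ℕ) :
    NormedSpace.exp (((k : ℂ) * s) • B) = NormedSpace.exp (s • B) ^ k := by
  induction k with
  | zero => simp
  | succ k ih => rw [Nat.cast_succ, add_mul, one_mul, exp_smul_add, ih, pow_succ]

theorem continuous_exp_smul (B : E →L[ℂ] E) :
    Continuous fun t : ℝ => NormedSpace.exp ((-(t : ℂ)) • B) := by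
  have h : Continuous fun c : ℂ => NormedSpace.exp (c • B) :=
    continuous_iff_continuousAt.2 fun c => (hasDerivAt_exp_smul_const B c).continuousAt
  exact h.comp (by fun_prop)

/-- Write `t = jk + s` with `s ∈ [0, k]`: the flow is bounded for times in the compact interval, and
each full period contributes a factor at most `r < 1`. -/
theorem exists_exp_decay [Nontrivial E] (B : E →L[ℂ] E)
    (hB : ∀ l ∈ spectrum ℂ B, 0 < l.re) :
    ∃ C a : ℝ, 0 < C ∧ 0 < a ∧
      ∀ t : ℝ, 0 ≤ t → ‖NormedSpace.exp ((-(t : ℂ)) • B)‖ ≤ C * Real.exp (-a * t) := by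
  obtain ⟨k, hk, hlt⟩ := exists_norm_exp_pow_lt_one B hB
  have hk0 : (0 : ℝ) < k := by exact_mod_cast hk
  -- The floor `1/2` keeps `r` positive, so that `log r` gives a genuine decay rate.
  set r : ℝ := max ‖NormedSpace.exp (-B) ^ k‖ (1 / 2) with hr
  have hr1 : r < 1 := max_lt hlt (by norm_num)
  have hr0 : 0 < r := lt_of_lt_of_le (by norm_num) (le_max_right _ _)
  obtain ⟨C, hC⟩ := (isCompact_Icc (a := (0 : ℝ)) (b := k)).exists_bound_of_continuousOn
    (continuous_exp_smul B).continuousOn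
  have hlog : Real.log r < 0 := Real.log_neg hr0 hr1
  refine ⟨(|C| + 1) * r⁻¹, -Real.log r / k, by positivity, div_pos (by linarith) hk0, ?_⟩
  intro t ht
  set j := ⌊t / k⌋₊ with hj
  have hj1 : (j : ℝ) ≤ t / k := Nat.floor_le (by positivity)
  have hj2 : t / k < j + 1 := Nat.lt_floor_add_one _
  have hs0 : 0 ≤ t - j * k := by
    have := (le_div_iff₀ hk0).1 hj1
    linarith
  have hs1 : t - j * k ≤ k := by
    have := (div_lt_iff₀ hk0).1 hj2
    linarith
  have hsplit : NormedSpace.exp ((-(t : ℂ)) • B) =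
      NormedSpace.exp ((-((t - j * k : ℝ) : ℂ)) • B) * (NormedSpace.exp (-B) ^ k) ^ j := by
    have h1 : (-(t : ℂ)) = (-((t - j * k : ℝ) : ℂ)) + (j : ℂ) * ((k : ℂ) * (-1)) := by
      push_cast; ring
    rw [h1, exp_smul_add, exp_nsmul_eq_pow, exp_nsmul_eq_pow, neg_one_smul]
  rw [hsplit]
  refine (norm_mul_le _ _).trans ?_
  have h2 : ‖NormedSpace.exp ((-((t - j * k : ℝ) : ℂ)) • B)‖ ≤ |C| + 1 :=
    (hC _ ⟨hs0, hs1⟩).trans (by linarith [le_abs_self C])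
  have h3 : ‖(NormedSpace.exp (-B) ^ k) ^ j‖ ≤ r ^ j := by
    rcases Nat.eq_zero_or_pos j with h0 | h0
    · rw [h0, pow_zero, pow_zero]
      exact ContinuousLinearMap.norm_id_le
    · exact (norm_pow_le' _ h0).trans (pow_le_pow_left₀ (norm_nonneg _) (le_max_left _ _) _)
  -- Since `j > t/k - 1` and `r < 1`; this is the source of the factor `r⁻¹` in the constant.
  have h4 : r ^ j ≤ r⁻¹ * Real.exp (-(-Real.log r / k) * t) := by
    rw [← Real.exp_log hr0, ← Real.exp_nat_mul, ← Real.exp_neg, ← Real.exp_add, Real.log_exp]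
    apply Real.exp_le_exp.2
    have : -(-Real.log r / k) * t = Real.log r * (t / k) := by field_simp
    rw [this]
    nlinarith
  calc _ ≤ (|C| + 1) * r ^ j := mul_le_mul h2 h3 (norm_nonneg _) (by positivity)
    _ ≤ (|C| + 1) * (r⁻¹ * Real.exp (-(-Real.log r / k) * t)) := by gcongr
    _ = _ := by ring

/-! ### Variation of constants and the stability estimate. -/

variable [NormedSpace ℝ E] [IsScalarTower ℝ ℂ E]

/-- Variation of constants in differential form: the two terms containing `B (w s)` cancel. -/
theorem hasDerivAt_exp_flow (B : E →L[ℂ] E) (w : ℝ → E) (h : E)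
    (t s : ℝ) (hw : HasDerivAt w (-(B (w s)) + h) s) :
    HasDerivAt (fun s : ℝ => NormedSpace.exp ((-((t - s : ℝ) : ℂ)) • B) (w s))
      (NormedSpace.exp ((-((t - s : ℝ) : ℂ)) • B) h) s := by
  have : CompleteSpace E := FiniteDimensional.complete ℂ E
  have h1 : HasDerivAt (fun s : ℝ => NormedSpace.exp ((-((t - s : ℝ) : ℂ)) • B))
      (NormedSpace.exp ((-((t - s : ℝ) : ℂ)) • B) * B) s := by
    have h2 := (hasDerivAt_exp_smul_const B (-((t - s : ℝ) : ℂ)))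
    have h3 : HasDerivAt (fun s : ℝ => (-((t - s : ℝ) : ℂ))) 1 s := by
      have := ((hasDerivAt_id s).const_sub t).ofReal_comp.neg
      exact (by simpa using this : HasDerivAt (-fun y : ℝ => (t : ℂ) - (y : ℂ)) 1 s).congr_of_eventuallyEq (.of_forall fun y => by simp)
    have := h2.scomp s h3
    simpa [Function.comp_def] using this
  have h4 := ((ContinuousLinearMap.restrictScalarsL ℂ (E) (E) ℝ ℝ).hasFDerivAt
    (x := NormedSpace.exp ((-((t - s : ℝ) : ℂ)) • B))).comp_hasDerivAt s h1
  have h5 := h4.clm_apply hw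
  refine h5.congr_deriv ?_
  change NormedSpace.exp ((-((t - s : ℝ) : ℂ)) • B) (B (w s)) +
    NormedSpace.exp ((-((t - s : ℝ) : ℂ)) • B) (-(B (w s)) + h) = _
  rw [map_add, map_neg]
  abel

/-- Absorption: let `M` be the maximum of `‖w‖/φ` on `[T, t]`, attained at `u`. Variation of
constants up to time `u` bounds `M` by `M/2` plus a constant independent of `t`. The weight loses at
most the rate `a/2`, so half of the decay of the flow survives. -/
theorem exists_stability (B : E →L[ℂ] E) {C a : ℝ} (hC : 0 < C) (ha : 0 < a)
    (hdec : ∀ t : ℝ, 0 ≤ t → ‖NormedSpace.exp ((-(t : ℂ)) • B)‖ ≤ C * Real.exp (-a * t)) :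
    ∃ ε : ℝ, 0 < ε ∧ ∀ (w h : ℝ → E) (φ : ℝ → ℝ) (K T : ℝ), 0 ≤ K →
      (∀ t, T ≤ t → HasDerivAt w (-(B (w t)) + h t) t) →
      (∀ t, T ≤ t → ‖h t‖ ≤ ε * ‖w t‖ + K * φ t) →
      (∀ t, T ≤ t → 0 < φ t) → ContinuousOn φ (Ici T) →
      (∀ s t, T ≤ s → s ≤ t → φ s ≤ φ t * Real.exp (a / 2 * (t - s))) →
      ∃ M, ∀ t, T ≤ t → ‖w t‖ ≤ M * φ t := by
  -- This `ε` makes the coefficient of `M` equal to `C * ε * (2 / a) = 1/2`.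
  refine ⟨a / (4 * C), by positivity, ?_⟩
  intro w h φ K T hK hw hh hφ hφc hφs
  refine ⟨2 * (C * ‖w T‖ / φ T + 2 * C * K / a), fun t ht => ?_⟩
  have hwc : ContinuousOn w (Icc T t) := fun s hs => (hw s hs.1).continuousAt.continuousWithinAt
  obtain ⟨u, hu, hmax⟩ := (isCompact_Icc (a := T) (b := t)).exists_isMaxOn ⟨T, le_rfl, ht⟩
    (f := fun s => ‖w s‖ / φ s) (hwc.norm.div (hφc.mono fun s hs => hs.1)
      fun s hs => (hφ s hs.1).ne')
  set M := ‖w u‖ / φ u with hM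
  have hφu := hφ u hu.1
  have hφT := hφ T le_rfl
  have hM0 : 0 ≤ M := div_nonneg (norm_nonneg _) hφu.le
  have hbound : ∀ s ∈ Icc T t, ‖w s‖ ≤ M * φ s := fun s hs =>
    (div_le_iff₀ (hφ s hs.1)).1 (hmax hs)
  set D := C * (a / (4 * C) * M + K) * φ u with hD
  have hD0 : 0 ≤ D := by positivity
  have hUT : ‖NormedSpace.exp ((-((u - T : ℝ) : ℂ)) • B) (w T)‖ ≤
      C * ‖w T‖ / φ T * φ u := by
    refine (ContinuousLinearMap.le_opNorm _ _).trans ?_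
    have h1 := hdec (u - T) (by linarith [hu.1])
    have h2 : Real.exp (-a * (u - T)) * φ T ≤ φ u := by
      have h3 := hφs T u le_rfl hu.1
      have h4 : Real.exp (-a * (u - T)) ≤ Real.exp (-(a / 2 * (u - T))) := by
        apply Real.exp_le_exp.2
        nlinarith [hu.1]
      calc _ ≤ Real.exp (-(a / 2 * (u - T))) * (φ u * Real.exp (a / 2 * (u - T))) := by
            gcongr
        _ = φ u := by rw [Real.exp_neg]; field_simp
    have h5 : Real.exp (-a * (u - T)) ≤ φ u / φ T := (le_div_iff₀ hφT).2 h2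
    calc _ ≤ C * Real.exp (-a * (u - T)) * ‖w T‖ := by gcongr
      _ ≤ C * (φ u / φ T) * ‖w T‖ := by gcongr
      _ = _ := by ring
  -- A mean value inequality replaces the Duhamel integral, so `h` need not be continuous. The
  -- boundary function is the antiderivative of `D e^{-(a/2)(u-s)}` starting at the norm of the flow
  -- at `s = T`.
  have key := image_norm_le_of_norm_deriv_right_le_deriv_boundary (a := T) (b := u)
    (f := fun s : ℝ => NormedSpace.exp ((-((u - s : ℝ) : ℂ)) • B) (w s))
    (f' := fun s : ℝ => NormedSpace.exp ((-((u - s : ℝ) : ℂ)) • B) (h s))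
    (fun s hs => (hasDerivAt_exp_flow B w (h s) u s (hw s hs.1)).continuousAt.continuousWithinAt)
    (fun s hs => (hasDerivAt_exp_flow B w (h s) u s (hw s hs.1)).hasDerivWithinAt)
    (B := fun s => ‖NormedSpace.exp ((-((u - T : ℝ) : ℂ)) • B) (w T)‖ +
      D * (2 / a) * (Real.exp (-(a / 2) * (u - s)) - Real.exp (-(a / 2) * (u - T))))
    (B' := fun s => D * Real.exp (-(a / 2) * (u - s)))
    (by simp)
    (by
      intro s
      have h1 : HasDerivAt (fun s : ℝ => -(a / 2) * (u - s)) (a / 2) s := by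
        have := ((hasDerivAt_id s).const_sub u).const_mul (-(a / 2))
        simpa using this
      have h2 := ((h1.exp.sub_const (Real.exp (-(a / 2) * (u - T)))).const_mul
        (D * (2 / a))).const_add ‖NormedSpace.exp ((-((u - T : ℝ) : ℂ)) • B) (w T)‖
      exact h2.congr_deriv (by field_simp))
    (by
      intro s hs
      refine (ContinuousLinearMap.le_opNorm _ _).trans ?_
      have h1 := hdec (u - s) (by linarith [hs.2])
      have h2 : ‖h s‖ ≤ (a / (4 * C) * M + K) * φ s := by
        have := hbound s ⟨hs.1, hs.2.le.trans hu.2⟩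
        calc _ ≤ _ := hh s hs.1
          _ ≤ a / (4 * C) * (M * φ s) + K * φ s := by gcongr
          _ = _ := by ring
      calc _ ≤ C * Real.exp (-a * (u - s)) * ((a / (4 * C) * M + K) * φ s) := by gcongr
        _ ≤ C * Real.exp (-a * (u - s)) * ((a / (4 * C) * M + K) *
            (φ u * Real.exp (a / 2 * (u - s)))) := by
          have := hφs s u hs.1 hs.2.le
          gcongr
        _ = D * (Real.exp (-a * (u - s)) * Real.exp (a / 2 * (u - s))) := by rw [hD]; ring
        _ = _ := by rw [← Real.exp_add]; ring_nf)
    (x := u) ⟨hu.1, le_rfl⟩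
  simp only [sub_self, Complex.ofReal_zero, neg_zero, zero_smul, NormedSpace.exp_zero, mul_zero,
    Real.exp_zero, one_apply_eq_self] at key
  have h6 : ‖w u‖ ≤ C * ‖w T‖ / φ T * φ u + D * (2 / a) := by
    have : 0 ≤ D * (2 / a) * Real.exp (-(a / 2) * (u - T)) := by positivity
    nlinarith
  have h7 : ‖w u‖ = M * φ u := by rw [hM]; field_simp
  have h8 : D * (2 / a) = (M / 2 + 2 * C * K / a) * φ u := by rw [hD]; field_simp; ring
  rw [h7, h8, ← add_mul] at h6
  have h9 := le_of_mul_le_mul_right h6 hφu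
  exact (hbound t ⟨ht, le_rfl⟩).trans
    (mul_le_mul_of_nonneg_right (by linarith) (hφ t ht).le)

end Stability

/-! ### Real vectors -/

theorem conjVec_toC {n : ℕ} (x : RVec n) : conjVec (toC x) = toC x := by
  ext i; simp [conjVec, toC]

theorem isRealVec_iff {n : ℕ} {v : CVec n} : IsRealVec v ↔ conjVec v = v := by
  constructor
  · rintro ⟨x, rfl⟩
    exact conjVec_toC x
  · intro h
    refine ⟨WithLp.toLp 2 fun i => (v i).re, ?_⟩
    ext i
    have : (starRingEnd ℂ) (v i) = v i := congrArg (fun w : CVec n => w i) h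
    exact (Complex.conj_eq_iff_re.1 this).symm

theorem conjVec_add {n : ℕ} (v w : CVec n) : conjVec (v + w) = conjVec v + conjVec w := by
  ext i; simp [conjVec]

theorem conjVec_zero {n : ℕ} : conjVec (0 : CVec n) = 0 := by
  ext i; simp [conjVec]

theorem conjVec_smul {n : ℕ} (c : ℂ) (v : CVec n) :
    conjVec (c • v) = (starRingEnd ℂ) c • conjVec v := by
  ext i; simp [conjVec]

theorem conjVec_sum {n : ℕ} {ι : Type*} (s : Finset ι) (v : ι → CVec n) :
    conjVec (∑ i ∈ s, v i) = ∑ i ∈ s, conjVec (v i) := by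
  ext i; simp [conjVec]

theorem IsRealVec.add {n : ℕ} {v w : CVec n} (hv : IsRealVec v) (hw : IsRealVec w) :
    IsRealVec (v + w) := by
  rw [isRealVec_iff] at *
  rw [conjVec_add, hv, hw]

theorem IsRealVec.smul {n : ℕ} {v : CVec n} (hv : IsRealVec v) {c : ℂ}
    (hc : (starRingEnd ℂ) c = c) : IsRealVec (c • v) := by
  rw [isRealVec_iff] at *
  rw [conjVec_smul, hv, hc]

theorem IsRealVec.sub {n : ℕ} {v w : CVec n} (hv : IsRealVec v) (hw : IsRealVec w) :
    IsRealVec (v - w) := by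
  have := hv.add (hw.smul (c := -1) (by simp))
  rwa [neg_one_smul, ← sub_eq_add_neg] at this

theorem isRealVec_zero {n : ℕ} : IsRealVec (0 : CVec n) := isRealVec_iff.2 conjVec_zero

theorem IsRealVec.sum {n : ℕ} {ι : Type*} {s : Finset ι} {v : ι → CVec n}
    (h : ∀ i ∈ s, IsRealVec (v i)) : IsRealVec (∑ i ∈ s, v i) :=
  Finset.sum_induction _ _ (fun _ _ => IsRealVec.add) isRealVec_zero h

theorem IsRealVec.complexify {n m : ℕ}
    (M : MultilinearMap ℝ (fun _ : Fin m => RVec n) (RVec n)) {z : Fin m → CVec n}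
    (hz : ∀ i, IsRealVec (z i)) : IsRealVec (complexify M z) := by
  choose x hx using hz
  obtain rfl : z = fun i => toC (x i) := funext hx
  exact ⟨_, complexify_toC M x⟩

/-! ### Spans of power functions -/

theorem vecPow_add {k : ℕ} (z : PosVec k) (α β : Fin (k + 2) → ℂ) :
    vecPow z (α + β) = vecPow z α * vecPow z β := by
  simp only [vecPow, ← Finset.prod_mul_distrib]
  exact Finset.prod_congr rfl fun i _ =>
    Complex.cpow_add _ _ (by exact_mod_cast (z i).2.ne')

theorem vecPow_zero {k : ℕ} (z : PosVec k) : vecPow z 0 = 1 := by simp [vecPow]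

theorem vecPow_star {k : ℕ} (z : PosVec k) (α : Fin (k + 2) → ℂ) :
    vecPow z (star α) = (starRingEnd ℂ) (vecPow z α) := by
  simp only [vecPow, map_prod]
  refine Finset.prod_congr rfl fun i _ => ?_
  have h := Complex.cpow_conj (((z i : ℝ) : ℂ)) (α i)
    (by rw [Complex.arg_ofReal_of_nonneg (z i).2.le]; exact Real.pi_pos.ne)
  rw [Complex.conj_ofReal] at h
  exact h

/-- `powerSum` as a linear map of the coefficients. -/
noncomputable def powerSumLin (n k : ℕ) :
    ((Fin (k + 2) → ℂ) →₀ CVec n) →ₗ[ℂ] (PosVec k → CVec n) where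
  toFun := powerSum
  map_add' ξ η := by
    funext z
    exact Finsupp.sum_add_index' (by simp) (by simp)
  map_smul' c ξ := by
    funext z
    simp only [powerSum, Pi.smul_apply, RingHom.id_apply]
    rw [Finsupp.sum_smul_index' (by simp), Finsupp.smul_sum]
    exact Finsupp.sum_congr fun a _ => smul_comm _ _ _

/-- The finite sums `∑ z^α ξ_α` with exponents in `E`. -/
noncomputable def powSpan (n : ℕ) {k : ℕ} (E : Set (Fin (k + 2) → ℂ)) :
    Submodule ℂ (PosVec k → CVec n) :=
  (Finsupp.supported (CVec n) ℂ E).map (powerSumLin n k)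

theorem mem_powSpan {n k : ℕ} {E : Set (Fin (k + 2) → ℂ)} {p : PosVec k → CVec n} :
    p ∈ powSpan n E ↔ ∃ ξ : (Fin (k + 2) → ℂ) →₀ CVec n,
      (∀ α ∈ ξ.support, α ∈ E) ∧ p = powerSum ξ := by
  constructor
  · rintro ⟨ξ, hξ, rfl⟩
    exact ⟨ξ, fun α hα => hξ hα, rfl⟩
  · rintro ⟨ξ, hξ, rfl⟩
    exact ⟨ξ, fun α hα => hξ _ hα, rfl⟩

theorem monomial_mem_powSpan {n k : ℕ} {E : Set (Fin (k + 2) → ℂ)} {α : Fin (k + 2) → ℂ}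
    (hα : α ∈ E) (v : CVec n) : (fun z => vecPow z α • v) ∈ powSpan n E :=
  ⟨Finsupp.single α v, Finsupp.single_mem_supported ℂ v hα, by
    funext z
    simp [powerSumLin, powerSum]⟩

theorem powSpan_induction {n k : ℕ} {E : Set (Fin (k + 2) → ℂ)}
    {motive : (PosVec k → CVec n) → Prop} (zero : motive 0)
    (add : ∀ p q, motive p → motive q → motive (p + q))
    (monomial : ∀ α ∈ E, ∀ v, motive fun z => vecPow z α • v)
    {p : PosVec k → CVec n} (hp : p ∈ powSpan n E) : motive p := by
  obtain ⟨ξ, hξ, rfl⟩ := mem_powSpan.1 hp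
  have : powerSum ξ = ∑ α ∈ ξ.support, fun z => vecPow z α • ξ α := by
    funext z
    simp [powerSum, Finsupp.sum]
  rw [this]
  exact Finset.sum_induction _ _ add zero fun α hα => monomial α (hξ α hα) _

theorem powSpan_mono {n k : ℕ} {E F : Set (Fin (k + 2) → ℂ)} (h : E ⊆ F) :
    powSpan n E ≤ powSpan n F :=
  Submodule.map_mono (Finsupp.supported_mono h)

theorem conjVec_powerSum {n k : ℕ} (ξ : (Fin (k + 2) → ℂ) →₀ CVec n) (z : PosVec k) :
    conjVec (powerSum ξ z) = powerSum ((Finsupp.equivMapDomain (Equiv.ofBijective star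
      star_involutive.bijective) ξ).mapRange conjVec conjVec_zero) z := by
  rw [powerSum, powerSum, Finsupp.sum_mapRange_index (by simp), Finsupp.sum_equivMapDomain,
    Finsupp.sum, conjVec_sum]
  refine Finset.sum_congr rfl fun α _ => ?_
  rw [conjVec_smul, ← vecPow_star]
  rfl

/-- Conjugating the function moves the conjugated coefficient at `α` to the exponent `star α`; as
coefficients are unique, being real amounts to their symmetry. -/
theorem isRealVec_powerSum_iff {n k : ℕ} {ξ : (Fin (k + 2) → ℂ) →₀ CVec n} :
    (∀ z, IsRealVec (powerSum ξ z)) ↔ ∀ α, ξ (star α) = conjVec (ξ α) := by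
  have h1 : (∀ z, IsRealVec (powerSum ξ z)) ↔ ((Finsupp.equivMapDomain (Equiv.ofBijective star
      star_involutive.bijective) ξ).mapRange conjVec conjVec_zero) = ξ := by
    constructor
    · intro h
      apply powerSum_injective
      funext z
      rw [← conjVec_powerSum]
      exact isRealVec_iff.1 (h z)
    · intro h z
      rw [isRealVec_iff, conjVec_powerSum, h]
  have h2 : ∀ α, ((Finsupp.equivMapDomain (Equiv.ofBijective star
      star_involutive.bijective) ξ).mapRange conjVec conjVec_zero) (star α) = conjVec (ξ α) := by
    intro α
    rw [Finsupp.mapRange_apply, Finsupp.equivMapDomain_apply]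
    congr 2
    exact (Equiv.symm_apply_eq _).2 rfl
  rw [h1, DFunLike.ext_iff]
  constructor
  · intro h α
    rw [← h (star α), h2]
  · intro h α
    have := h2 (star α)
    rw [star_star] at this
    rw [this, ← h, star_star]

/-- Separates the condition on exponents, which is complex linear, from reality of the values;
closure properties can then be checked for each independently. -/
theorem mem_classP_iff {n m k : ℕ} {μ : ℝ} {p : PosVec k → CVec n} :
    p ∈ ClassP n m k μ ↔ p ∈ powSpan n (expSet m k μ) ∧ ∀ z, IsRealVec (p z) := by
  rw [mem_powSpan]
  constructor
  · rintro ⟨ξ, h1, h2, rfl⟩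
    exact ⟨⟨ξ, h1, rfl⟩, isRealVec_powerSum_iff.2 h2⟩
  · rintro ⟨⟨ξ, h1, rfl⟩, h2⟩
    exact ⟨ξ, h1, isRealVec_powerSum_iff.1 h2, rfl⟩

theorem ClassP.add {n m k : ℕ} {μ : ℝ} {p q : PosVec k → CVec n} (hp : p ∈ ClassP n m k μ)
    (hq : q ∈ ClassP n m k μ) : p + q ∈ ClassP n m k μ := by
  rw [mem_classP_iff] at *
  exact ⟨add_mem hp.1 hq.1, fun z => (hp.2 z).add (hq.2 z)⟩

theorem ClassP.sub {n m k : ℕ} {μ : ℝ} {p q : PosVec k → CVec n} (hp : p ∈ ClassP n m k μ)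
    (hq : q ∈ ClassP n m k μ) : p - q ∈ ClassP n m k μ := by
  rw [mem_classP_iff] at *
  exact ⟨sub_mem hp.1 hq.1, fun z => (hp.2 z).sub (hq.2 z)⟩

theorem ClassP.zero {n m k : ℕ} {μ : ℝ} : (0 : PosVec k → CVec n) ∈ ClassP n m k μ :=
  mem_classP_iff.2 ⟨zero_mem _, fun _ => isRealVec_zero⟩

theorem ClassP.sum {n m k : ℕ} {μ : ℝ} {ι : Type*} {s : Finset ι} {p : ι → PosVec k → CVec n}
    (h : ∀ i ∈ s, p i ∈ ClassP n m k μ) : ∑ i ∈ s, p i ∈ ClassP n m k μ :=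
  Finset.sum_induction _ _ (fun _ _ => ClassP.add) ClassP.zero h

/-! ### Products -/

/-- The finite scalar sums `∑ c_α z^α` with exponents in `E`. -/
noncomputable def scalSpan {k : ℕ} (E : Set (Fin (k + 2) → ℂ)) : Submodule ℂ (PosVec k → ℂ) :=
  Submodule.span ℂ ((fun α z => vecPow z α) '' E)

theorem expSet_add {m k : ℕ} {μ ν : ℝ} {α β : Fin (k + 2) → ℂ} (hα : α ∈ expSet m k μ)
    (hβ : β ∈ expSet m k ν) : α + β ∈ expSet m k (μ + ν) := by
  intro i
  refine ⟨fun h => ?_, fun h => ?_⟩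
  · simp [(hα i).1 h, (hβ i).1 h]
  · simp [(hα i).2 h, (hβ i).2 h]

theorem scalSpan_mul {m k : ℕ} {μ ν : ℝ} {φ ψ : PosVec k → ℂ}
    (hφ : φ ∈ scalSpan (expSet m k μ)) (hψ : ψ ∈ scalSpan (expSet m k ν)) :
    φ * ψ ∈ scalSpan (expSet m k (μ + ν)) := by
  have h := Submodule.mul_mem_mul hφ hψ
  rw [scalSpan, scalSpan, Submodule.span_mul_span] at h
  refine Submodule.span_mono ?_ h
  rintro _ ⟨_, ⟨α, hα, rfl⟩, _, ⟨β, hβ, rfl⟩, rfl⟩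
  exact ⟨α + β, expSet_add hα hβ, funext fun z => vecPow_add z α β⟩

theorem scalSpan_prod {m k : ℕ} {ι : Type*} (s : Finset ι) (μ : ι → ℝ) (φ : ι → PosVec k → ℂ)
    (hφ : ∀ i ∈ s, φ i ∈ scalSpan (expSet m k (μ i))) :
    (fun z => ∏ i ∈ s, φ i z) ∈ scalSpan (expSet m k (∑ i ∈ s, μ i)) := by
  classical
  induction s using Finset.induction_on with
  | empty =>
    refine Submodule.subset_span ⟨0, fun i => by simp, ?_⟩
    funext z
    simp [vecPow_zero]
  | insert a s ha ih =>
    rw [Finset.sum_insert ha]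
    have := scalSpan_mul (hφ a (Finset.mem_insert_self a s))
      (ih fun i hi => hφ i (Finset.mem_insert_of_mem hi))
    convert this using 1
    funext z
    simp [Finset.prod_insert ha]

theorem coord_mem_scalSpan {n k : ℕ} {E : Set (Fin (k + 2) → ℂ)} {p : PosVec k → CVec n}
    (hp : p ∈ powSpan n E) (i : Fin n) : (fun z => p z i) ∈ scalSpan E := by
  refine powSpan_induction (motive := fun p => (fun z => p z i) ∈ scalSpan E)
    (zero_mem _) (fun p q hp hq => add_mem hp hq) (fun α hα v => ?_) hp
  · have : (fun z => vecPow z α) ∈ scalSpan E := Submodule.subset_span ⟨α, hα, rfl⟩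
    convert Submodule.smul_mem _ (v i) this using 1
    funext z
    simp [mul_comm]

theorem smul_mem_powSpan {n k : ℕ} {E : Set (Fin (k + 2) → ℂ)} {φ : PosVec k → ℂ}
    (hφ : φ ∈ scalSpan E) (v : CVec n) : (fun z => φ z • v) ∈ powSpan n E := by
  induction hφ using Submodule.span_induction with
  | mem φ hφ =>
    obtain ⟨α, hα, rfl⟩ := hφ
    exact monomial_mem_powSpan hα v
  | zero => convert zero_mem (powSpan n E) using 1; funext z; simp
  | add φ ψ _ _ h1 h2 => convert add_mem h1 h2 using 1; funext z; simp [add_smul]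
  | smul c φ _ h => convert Submodule.smul_mem _ c h using 1; funext z; simp [smul_smul]

/-- In coordinates a multilinear map is a sum of products of scalar power sums, and exponents add
under multiplication. -/
theorem complexify_mem_powSpan {n m k r : ℕ} {μ : Fin r → ℝ}
    (M : MultilinearMap ℝ (fun _ : Fin r => RVec n) (RVec n)) {p : Fin r → PosVec k → CVec n}
    (hp : ∀ i, p i ∈ powSpan n (expSet m k (μ i))) :
    (fun z => complexify M fun i => p i z) ∈ powSpan n (expSet m k (∑ i, μ i)) := by
  have : (fun z => complexify M fun i => p i z) = ∑ J : Fin r → Fin n, fun z =>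
      (∏ i, p i z (J i)) • toC (M fun i => EuclideanSpace.single (J i) 1) := by
    funext z
    simp [complexify]
  rw [this]
  exact sum_mem fun J _ => smul_mem_powSpan
    (scalSpan_prod _ _ _ fun i _ => coord_mem_scalSpan (hp i) (J i)) _

theorem ClassP.complexify {n m k r : ℕ} {μ : Fin r → ℝ}
    (M : MultilinearMap ℝ (fun _ : Fin r => RVec n) (RVec n)) {p : Fin r → PosVec k → CVec n}
    (hp : ∀ i, p i ∈ ClassP n m k (μ i)) :
    (fun z => _root_.complexify M fun i => p i z) ∈ ClassP n m k (∑ i, μ i) := by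
  simp only [mem_classP_iff] at *
  exact ⟨complexify_mem_powSpan M fun i => (hp i).1,
    fun z => IsRealVec.complexify M fun i => (hp i).2 z⟩

/-! ### Embeddings -/

/-- The extension of exponent vectors by zero. -/
def extendExp (a b : ℕ) (α : Fin (a + 2) → ℂ) : Fin (b + 2) → ℂ :=
  fun i => if h : (i : ℕ) < a + 2 then α ⟨i, h⟩ else 0

theorem vecPow_extendExp {a b : ℕ} (hab : a ≤ b) (z : PosVec b) (α : Fin (a + 2) → ℂ) :
    vecPow (fun i : Fin (a + 2) => if h : (i : ℕ) < b + 2 then z ⟨i, h⟩ else 1) α =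
      vecPow z (extendExp a b α) := by
  have hle : a + 2 ≤ b + 2 := by omega
  rw [vecPow, vecPow, ← Finset.prod_subset (Finset.subset_univ
    (Finset.univ.map (Fin.castLEEmb hle))), Finset.prod_map]
  · refine Finset.prod_congr rfl fun i _ => ?_
    have h1 : (i : ℕ) < b + 2 := by omega
    simp [extendExp, h1, Fin.castLE]
  · intro i _ hi
    have : ¬ (i : ℕ) < a + 2 := fun h => hi (Finset.mem_map.2 ⟨⟨i, h⟩, Finset.mem_univ _, rfl⟩)
    simp [extendExp, this]

/-- The bound `m ≤ a` ensures that every constrained exponent is an original one, not one of the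
appended zeros. -/
theorem extendExp_mem {m a b : ℕ} (hm : m ≤ a) {μ : ℝ} {α : Fin (a + 2) → ℂ}
    (hα : α ∈ expSet m a μ) : extendExp a b α ∈ expSet m b μ := by
  intro i
  refine ⟨fun h => ?_, fun h => ?_⟩
  · have h1 : (i : ℕ) < a + 2 := by omega
    simpa [extendExp, h1] using (hα ⟨i, h1⟩).1 h
  · have h1 : (i : ℕ) < a + 2 := by omega
    simpa only [extendExp, h1, dif_pos] using (hα ⟨i, h1⟩).2 h

theorem embedP_mem_powSpan {n m a b : ℕ} (hm : m ≤ a) (hab : a ≤ b) {μ : ℝ}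
    {p : PosVec a → CVec n} (hp : p ∈ powSpan n (expSet m a μ)) :
    embedP a b p ∈ powSpan n (expSet m b μ) := by
  refine powSpan_induction (motive := fun p => embedP a b p ∈ powSpan n (expSet m b μ))
    (zero_mem _) (fun p q hp hq => add_mem hp hq) (fun α hα v => ?_) hp
  · convert monomial_mem_powSpan (extendExp_mem (b := b) hm hα) v using 1
    funext z
    rw [embedP, vecPow_extendExp hab]

theorem ClassP.embedP {n m a b : ℕ} (hm : m ≤ a) (hab : a ≤ b) {μ : ℝ}
    {p : PosVec a → CVec n} (hp : p ∈ ClassP n m a μ) :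
    _root_.embedP a b p ∈ ClassP n m b μ := by
  rw [mem_classP_iff] at *
  exact ⟨embedP_mem_powSpan hm hab hp.1, fun z => hp.2 _⟩

/-! ### Operators acting on the coefficients -/

/-- The coefficients `f_α ξ_α`. -/
noncomputable def mapCoeff {n k : ℕ} (f : (Fin (k + 2) → ℂ) → CVec n →ₗ[ℂ] CVec n)
    (ξ : (Fin (k + 2) → ℂ) →₀ CVec n) : (Fin (k + 2) → ℂ) →₀ CVec n :=
  Finsupp.onFinset ξ.support (fun α => f α (ξ α)) fun α h => by
    rw [Finsupp.mem_support_iff]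
    rintro h0
    exact h (by rw [h0, map_zero])

theorem mapCoeff_apply {n k : ℕ} (f : (Fin (k + 2) → ℂ) → CVec n →ₗ[ℂ] CVec n)
    (ξ : (Fin (k + 2) → ℂ) →₀ CVec n) (α) : mapCoeff f ξ α = f α (ξ α) := rfl

theorem powerSum_mapCoeff {n k : ℕ} (f : (Fin (k + 2) → ℂ) → CVec n →ₗ[ℂ] CVec n)
    (ξ : (Fin (k + 2) → ℂ) →₀ CVec n) (z : PosVec k) :
    powerSum (mapCoeff f ξ) z = ξ.sum fun α v => vecPow z α • f α v := by
  rw [powerSum, mapCoeff, Finsupp.onFinset_sum _ (by simp)]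
  rfl

theorem support_mapCoeff {n k : ℕ} (f : (Fin (k + 2) → ℂ) → CVec n →ₗ[ℂ] CVec n)
    (ξ : (Fin (k + 2) → ℂ) →₀ CVec n) : (mapCoeff f ξ).support ⊆ ξ.support :=
  Finsupp.support_onFinset_subset

theorem opM_powerSum {n k : ℕ} (i : Fin (k + 2)) (ξ : (Fin (k + 2) → ℂ) →₀ CVec n) :
    opM i (powerSum ξ) = powerSum (mapCoeff (fun α => α i • LinearMap.id) ξ) := by
  funext z
  rw [powerSum_mapCoeff, opM, coeffs_powerSum]
  exact Finsupp.sum_congr fun α _ => by simp [smul_smul, mul_comm]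

theorem opZ_powerSum {n k : ℕ} (A : Matrix (Fin n) (Fin n) ℂ)
    (ξ : (Fin (k + 2) → ℂ) →₀ CVec n) :
    opZ A (powerSum ξ) = powerSum (mapCoeff (fun α => Matrix.toEuclideanLin
      ((A + α 0 • (1 : Matrix (Fin n) (Fin n) ℂ))⁻¹)) ξ) := by
  funext z
  rw [powerSum_mapCoeff, opZ, coeffs_powerSum]

theorem ClassP.mapCoeff {n m k : ℕ} {μ : ℝ} (f : (Fin (k + 2) → ℂ) → CVec n →ₗ[ℂ] CVec n)
    (hf : ∀ α v, f (star α) (conjVec v) = conjVec (f α v)) {ξ : (Fin (k + 2) → ℂ) →₀ CVec n}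
    (hξ : powerSum ξ ∈ ClassP n m k μ) : powerSum (_root_.mapCoeff f ξ) ∈ ClassP n m k μ := by
  obtain ⟨η, h1, h2, h3⟩ := hξ
  obtain rfl := powerSum_injective h3
  refine ⟨_, fun α hα => h1 α (support_mapCoeff f ξ hα), fun α => ?_, rfl⟩
  rw [mapCoeff_apply, mapCoeff_apply, h2, hf]

theorem ClassP.opM {n m k : ℕ} {μ : ℝ} (i : Fin (k + 2)) {p : PosVec k → CVec n}
    (hp : p ∈ ClassP n m k μ) : _root_.opM i p ∈ ClassP n m k μ := by
  have hp' := hp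
  obtain ⟨ξ, -, -, rfl⟩ := hp
  rw [opM_powerSum]
  refine ClassP.mapCoeff _ (fun α v => ?_) hp'
  simp [conjVec_smul]

theorem conjVec_toEuclideanLin {n : ℕ} (M : Matrix (Fin n) (Fin n) ℂ) (v : CVec n) :
    conjVec (Matrix.toEuclideanLin M v) =
      Matrix.toEuclideanLin (M.map (starRingEnd ℂ)) (conjVec v) := by
  ext i
  simp [conjVec, Matrix.toEuclideanLin, Matrix.mulVec, dotProduct]

theorem inv_map_conj {n : ℕ} (M : Matrix (Fin n) (Fin n) ℂ) :
    (M⁻¹).map (starRingEnd ℂ) = (M.map (starRingEnd ℂ))⁻¹ := by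
  have h : ∀ N : Matrix (Fin n) (Fin n) ℂ, N.map (starRingEnd ℂ) = N.conjTranspose.transpose :=
    fun N => by ext i j; simp
  rw [h, h, Matrix.conjTranspose_nonsing_inv, Matrix.transpose_nonsing_inv]

theorem ClassP.opZ {n m k : ℕ} {μ : ℝ} (A : Matrix (Fin n) (Fin n) ℝ) {p : PosVec k → CVec n}
    (hp : p ∈ ClassP n m k μ) : _root_.opZ (A.map (algebraMap ℝ ℂ)) p ∈ ClassP n m k μ := by
  have hp' := hp
  obtain ⟨ξ, -, -, rfl⟩ := hp
  rw [opZ_powerSum]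
  refine ClassP.mapCoeff _ (fun α v => ?_) hp'
  rw [conjVec_toEuclideanLin, inv_map_conj]
  congr 3
  ext i j
  by_cases h : i = j <;> simp [h]

theorem isUnit_add_smul_one {n : ℕ} {A : Matrix (Fin n) (Fin n) ℂ}
    (hA : ∀ l ∈ spectrum ℂ A, 0 < l.re) {c : ℂ} (hc : c.re = 0) :
    IsUnit (A + c • (1 : Matrix (Fin n) (Fin n) ℂ)) := by
  by_contra h
  have : -c ∈ spectrum ℂ A := by
    rw [spectrum.mem_iff]
    intro h1
    apply h
    have h2 : A + c • (1 : Matrix (Fin n) (Fin n) ℂ) =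
        -(algebraMap ℂ (Matrix (Fin n) (Fin n) ℂ) (-c) - A) := by
      rw [Algebra.algebraMap_eq_smul_one]
      simp
    rw [h2]
    exact h1.neg
  have h3 := hA _ this
  simp [hc] at h3

/-- Coefficientwise this is `(A + α_{-1})(A + α_{-1})⁻¹ ξ = ξ`, where index `0` stands for `j = -1`.
Invertibility holds because `-α_{-1}` is purely imaginary and so is no eigenvalue of `A`. -/
theorem opZ_equation {n m k : ℕ} {μ : ℝ} {A : Matrix (Fin n) (Fin n) ℂ}
    (hA : ∀ l ∈ spectrum ℂ A, 0 < l.re) {p : PosVec k → CVec n}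
    (hp : p ∈ powSpan n (expSet m k μ)) (z : PosVec k) :
    Matrix.toEuclideanLin A (opZ A p z) + opM 0 (opZ A p) z = p z := by
  obtain ⟨ξ, hξ, rfl⟩ := mem_powSpan.1 hp
  rw [opZ_powerSum, opM_powerSum, powerSum_mapCoeff, powerSum_mapCoeff, powerSum]
  rw [Finsupp.sum_of_support_subset _ (support_mapCoeff _ ξ) _ (by simp)]
  simp only [Finsupp.sum, map_sum, ← Finset.sum_add_distrib]
  refine Finset.sum_congr rfl fun α hα => ?_
  have hu := isUnit_add_smul_one hA (c := α 0) ((hξ α hα 0).1 m.succ_pos)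
  rw [mapCoeff_apply, map_smul, ← smul_add]
  congr 1
  set N := A + α 0 • (1 : Matrix (Fin n) (Fin n) ℂ) with hN
  have h1 : Matrix.toEuclideanLin N (Matrix.toEuclideanLin N⁻¹ (ξ α)) = ξ α := by
    simp only [Matrix.toEuclideanLin, Matrix.toLpLin_apply, Matrix.mulVec_mulVec]
    rw [Matrix.mul_nonsing_inv _ ((Matrix.isUnit_iff_isUnit_det _).1 hu)]
    simp
  conv_rhs => rw [← h1, hN, map_add, map_smul]
  simp [← hN, Matrix.toEuclideanLin]

/-- The exponent of `z_0⁻¹ ⋯ z_j⁻¹`. -/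
def shiftExp {k : ℕ} (j : Fin (k + 1)) : Fin (k + 2) → ℂ :=
  Fin.cons 0 fun i => if i ≤ j then -1 else 0

theorem prod_inv_eq_vecPow {k : ℕ} (j : Fin (k + 1)) (z : PosVec k) :
    ∏ i ∈ Finset.Iic j, (((z i.succ : ℝ) : ℂ))⁻¹ = vecPow z (shiftExp j) := by
  rw [vecPow, Fin.prod_univ_succ]
  simp only [shiftExp, Fin.cons_zero, Fin.cons_succ, Complex.cpow_zero, one_mul]
  rw [← Finset.prod_subset (Finset.subset_univ (Finset.Iic j))]
  · exact Finset.prod_congr rfl fun i hi => by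
      rw [if_pos (Finset.mem_Iic.1 hi), Complex.cpow_neg_one]
  · intro i _ hi
    rw [if_neg fun h => hi (Finset.mem_Iic.2 h), Complex.cpow_zero]

/-- Every factor `z_0⁻¹ ⋯ z_j⁻¹` lowers the exponent of `z_0` by exactly one, and at level `0` the
exponents of the later variables are unrestricted. -/
theorem opR_mem_powSpan {n k : ℕ} {μ : ℝ} {p : PosVec k → CVec n}
    (hp : p ∈ powSpan n (expSet 0 k μ)) : opR p ∈ powSpan n (expSet 0 k (μ - 1)) := by
  obtain ⟨ξ, hξ, rfl⟩ := mem_powSpan.1 hp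
  have : opR (powerSum ξ) = ∑ j : Fin (k + 1), fun z =>
      vecPow z (shiftExp j) • opM j.succ (powerSum ξ) z := by
    funext z
    rw [opR, Finset.sum_apply]
    exact Finset.sum_congr rfl fun j _ => by rw [prod_inv_eq_vecPow]
  rw [this]
  refine sum_mem fun j _ => ?_
  have h1 : opM j.succ (powerSum ξ) ∈ powSpan n (expSet 0 k μ) := by
    rw [opM_powerSum]
    exact mem_powSpan.2 ⟨_, fun α hα => hξ α (support_mapCoeff _ ξ hα), rfl⟩
  refine powSpan_induction (motive := fun p => (fun z => vecPow z (shiftExp j) • p z) ∈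
    powSpan n (expSet 0 k (μ - 1))) ?_ (fun p q hp hq => ?_) (fun α hα v => ?_) h1
  · convert zero_mem (powSpan n (expSet 0 k (μ - 1))) using 1
    funext z
    simp
  · convert add_mem hp hq using 1
    funext z
    simp
  · have h2 : shiftExp j + α ∈ expSet 0 k (μ - 1) := by
      intro i
      refine ⟨fun h => ?_, fun h => ?_⟩
      · have : i = 0 := Fin.ext (by simp at h; simp [h])
        subst this
        simp [shiftExp, (hα 0).1 h]
      · have : i = (0 : Fin (k + 1)).succ := Fin.ext (by simp at h; simp [h])
        subst this
        rw [Pi.add_apply, Complex.add_re, (hα _).2 h, shiftExp, Fin.cons_succ,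
          if_pos (Fin.zero_le _)]
        simp; ring
    convert monomial_mem_powSpan h2 v using 1
    funext z
    rw [vecPow_add, smul_smul]

theorem ClassP.opR {n k : ℕ} {μ : ℝ} {p : PosVec k → CVec n}
    (hp : p ∈ ClassP n 0 k μ) : _root_.opR p ∈ ClassP n 0 k (μ - 1) := by
  rw [mem_classP_iff]
  refine ⟨opR_mem_powSpan (mem_classP_iff.1 hp).1, fun z => ?_⟩
  refine IsRealVec.sum fun j _ => IsRealVec.smul ((mem_classP_iff.1 (ClassP.opM j.succ hp)).2 z) ?_
  simp [map_prod]

/-! ### Iterated logarithms -/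

theorem tendsto_iterLog (m : ℕ) : Tendsto (iterLog m) atTop atTop := by
  induction m with
  | zero => exact tendsto_id
  | succ m ih => exact Real.tendsto_log_atTop.comp ih

theorem eventually_iterLog_pos (m : ℕ) : ∀ᶠ t in atTop, 0 < iterLog m t :=
  (tendsto_iterLog m).eventually_gt_atTop 0

theorem iterLog_pos {j k : ℕ} (h : j ≤ k) {t : ℝ} (ht : iterExp k 0 < t) : 0 < iterLog j t :=
  lt_iterLog j 0 t ((iterExp_mono h 0).trans_lt ht)

theorem hasDerivAt_iterLog_succ {j : ℕ} {t : ℝ} (ht : iterExp j 0 < t) :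
    HasDerivAt (iterLog (j + 1)) (∏ i ∈ Finset.range (j + 1), (iterLog i t)⁻¹) t := by
  induction j with
  | zero =>
    have h := Real.hasDerivAt_log (x := t) (by simpa [iterExp] using ht.ne')
    simpa [iterLog] using h
  | succ j ih =>
    have h := (ih ((iterExp_mono (Nat.le_succ j) 0).trans_lt ht)).log
      (iterLog_pos le_rfl ht).ne'
    rw [Finset.prod_range_succ, ← div_eq_mul_inv]
    exact h

theorem hasDerivAt_iterLog_zero (t : ℝ) : HasDerivAt (iterLog 0) 1 t := hasDerivAt_id t

theorem iterLog_isLittleO {i j : ℕ} (h : i < j) : iterLog j =o[atTop] iterLog i := by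
  have hs : ∀ i, iterLog (i + 1) =o[atTop] iterLog i := fun i =>
    Real.isLittleO_log_id_atTop.comp_tendsto (tendsto_iterLog i)
  induction j, h using Nat.le_induction with
  | base => exact hs i
  | succ j _ ih => exact (hs j).trans ih

theorem iterLog_rpow_eq_exp (m : ℕ) (x : ℝ) {t : ℝ} (ht : 0 < iterLog m t) :
    iterLog m t ^ x = Real.exp (x * iterLog (m + 1) t) := by
  rw [Real.rpow_def_of_pos ht, mul_comm]
  rfl

theorem iterLog_rpow_isBigO (m : ℕ) {x y : ℝ} (h : x ≤ y) :
    (fun t => iterLog m t ^ x) =O[atTop] fun t => iterLog m t ^ y := by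
  refine IsBigO.of_bound 1 ?_
  filter_upwards [(tendsto_iterLog m).eventually_ge_atTop 1] with t ht
  rw [one_mul, Real.norm_of_nonneg (by positivity), Real.norm_of_nonneg (by positivity)]
  exact Real.rpow_le_rpow_of_exponent_le ht h

/-- Compare exponents: `x L_1` with `x < 0` dominates `y L_{m+1}`, since `L_{m+1} = o(L_1)` when `m
≥ 1`. -/
theorem rpow_isBigO_iterLog_rpow {m : ℕ} (hm : 1 ≤ m) {x : ℝ} (hx : x < 0) (y : ℝ) :
    (fun t => iterLog 0 t ^ x) =O[atTop] fun t => iterLog m t ^ y := by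
  refine IsBigO.of_bound 1 ?_
  have h := ((iterLog_isLittleO (i := 1) (j := m + 1) (by omega)).const_mul_left (-y)).bound
    (neg_pos.2 hx)
  filter_upwards [eventually_iterLog_pos 0, eventually_iterLog_pos m, eventually_iterLog_pos 1, h]
    with t h0 hmt h1 h
  rw [one_mul, Real.norm_of_nonneg (by positivity), Real.norm_of_nonneg (by positivity),
    iterLog_rpow_eq_exp _ _ h0, iterLog_rpow_eq_exp _ _ hmt]
  apply Real.exp_le_exp.2
  rw [Real.norm_of_nonneg h1.le] at h
  have := (Real.le_norm_self _).trans h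
  simp only [zero_add]
  linarith

theorem tendsto_iterLog_rpow_neg (m : ℕ) {x : ℝ} (hx : 0 < x) :
    Tendsto (fun t => iterLog m t ^ (-x)) atTop (𝓝 0) :=
  (tendsto_rpow_neg_atTop hx).comp (tendsto_iterLog m)

/-- Supplies the weight for the stability estimate. As `L_m^{-x} = exp(-x L_{m+1})` and the
derivative of `L_{m+1}` tends to `0`, that derivative is eventually at most `a/x`. -/
theorem exists_iterLog_rpow_slow (m : ℕ) {x a : ℝ} (hx : 0 < x) (ha : 0 < a) :
    ∀ᶠ T in atTop, (∀ t, T ≤ t → 0 < iterLog m t) ∧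
      ContinuousOn (fun t => iterLog m t ^ (-x)) (Ici T) ∧
      ∀ s t, T ≤ s → s ≤ t →
        iterLog m s ^ (-x) ≤ iterLog m t ^ (-x) * Real.exp (a * (t - s)) := by
  have hd : Tendsto (fun t => ∏ i ∈ Finset.range (m + 1), (iterLog i t)⁻¹) atTop (𝓝 0) := by
    have := tendsto_finsetProd (f := fun i t => (iterLog i t)⁻¹) (Finset.range (m + 1))
      fun i _ => (tendsto_inv_atTop_zero.comp (tendsto_iterLog i))
    simpa using this
  have h1 := (hd.eventually (gt_mem_nhds (div_pos ha hx))).and (eventually_gt_atTop (iterExp m 0))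
  obtain ⟨T₀, hT₀⟩ := eventually_atTop.1 h1
  filter_upwards [eventually_ge_atTop T₀] with T hT
  have hpos : ∀ t, T ≤ t → 0 < iterLog m t := fun t ht =>
    iterLog_pos le_rfl (hT₀ t (hT.trans ht)).2
  refine ⟨hpos, ?_, ?_⟩
  · have hexp : ContinuousOn (fun t => Real.exp (-x * iterLog (m + 1) t)) (Ici T) := fun t ht =>
      ((hasDerivAt_iterLog_succ (hT₀ t (hT.trans ht)).2).continuousAt.const_mul
        (-x)).rexp.continuousWithinAt
    exact hexp.congr fun t ht => iterLog_rpow_eq_exp m _ (hpos t ht)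
  · intro s t hs hst
    rw [iterLog_rpow_eq_exp m _ (hpos s hs), iterLog_rpow_eq_exp m _ (hpos t (hs.trans hst)),
      ← Real.exp_add]
    apply Real.exp_le_exp.2
    have hmv := (convex_Ici T).image_sub_le_mul_sub_of_deriv_le (f := iterLog (m + 1))
      (fun t ht =>
        (hasDerivAt_iterLog_succ (hT₀ t (hT.trans ht)).2).continuousAt.continuousWithinAt)
      (fun t ht => (hasDerivAt_iterLog_succ
        (hT₀ t (hT.trans (interior_subset ht))).2).differentiableAt.differentiableWithinAt)
      (C := a / x) (fun t ht => by
        have := hT₀ t (hT.trans (interior_subset ht))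
        rw [(hasDerivAt_iterLog_succ this.2).deriv]
        exact this.1.le) s hs t (hs.trans hst) hst
    have : x * (a / x * (t - s)) = a * (t - s) := by field_simp
    nlinarith

/-! ### Power functions along the iterated logarithms -/

theorem log_lseq (t : ℝ) (i : ℕ) : Real.log (lseq t i) = iterLog i t := by
  cases i with
  | zero => exact Real.log_exp t
  | succ i => rfl

/-- Taking logarithms shifts the scale by one, so that index `i`, which carries `L_{i-1}`, is paired
with `L_i`. -/
theorem vecPow_lhat {k : ℕ} {t : ℝ} (ht : iterExp k 0 < t) (α : Fin (k + 2) → ℂ) :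
    vecPow (lhat k t ht) α = Complex.exp (∑ i : Fin (k + 2), (iterLog i t : ℂ) * α i) := by
  rw [vecPow, Complex.exp_sum]
  refine Finset.prod_congr rfl fun i _ => ?_
  have h := lseq_pos ht i
  rw [Complex.cpow_def_of_ne_zero (by exact_mod_cast h.ne')]
  change Complex.exp (Complex.log ((lseq t i : ℝ) : ℂ) * α i) = _
  rw [← Complex.ofReal_log h.le, log_lseq]

theorem compL_of_lt {n k : ℕ} (p : PosVec k → CVec n) {t : ℝ} (ht : iterExp k 0 < t) :
    compL p t = p (lhat k t ht) := by
  rw [compL, dif_pos ht]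

theorem norm_vecPow_lhat {k : ℕ} {t : ℝ} (ht : iterExp k 0 < t) (α : Fin (k + 2) → ℂ) :
    ‖vecPow (lhat k t ht) α‖ = Real.exp (∑ i : Fin (k + 2), (α i).re * iterLog i t) := by
  rw [vecPow_lhat, Complex.norm_exp, Complex.re_sum]
  simp [mul_comm]

/-- Exponents before position `m + 1` have zero real part, and later ones multiply functions that
are `o(L_{m+1})`. -/
theorem sum_exponent_isLittleO {m k : ℕ} (hmk : m ≤ k) {μ : ℝ} {α : Fin (k + 2) → ℂ}
    (hα : α ∈ expSet m k μ) :
    (fun t => ∑ i : Fin (k + 2), (α i).re * iterLog i t - μ * iterLog (m + 1) t) =o[atTop]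
      iterLog (m + 1) := by
  have hlt : m + 1 < k + 2 := by omega
  have h : (fun t => ∑ i : Fin (k + 2), (α i).re * iterLog i t - μ * iterLog (m + 1) t) =
      fun t => ∑ i ∈ Finset.univ.erase (⟨m + 1, hlt⟩ : Fin (k + 2)),
        (α i).re * iterLog i t := by
    funext t
    rw [← Finset.add_sum_erase _ _ (Finset.mem_univ (⟨m + 1, hlt⟩ : Fin (k + 2))),
      (hα ⟨m + 1, hlt⟩).2 rfl]
    ring
  rw [h]
  refine IsLittleO.fun_sum (A := fun (i : Fin (k + 2)) t => (α i).re * iterLog i t) fun i hi => ?_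
  have hne : (i : ℕ) ≠ m + 1 := fun h => (Finset.mem_erase.1 hi).1 (Fin.ext h)
  rcases lt_or_gt_of_ne hne with h1 | h1
  · simp only [(hα i).1 h1, zero_mul]
    exact isLittleO_zero _ _
  · exact (iterLog_isLittleO h1).const_mul_left _

/-- The strict loss `μ < μ'` pays for the arbitrary powers of the slower logarithms. -/
theorem compL_isBigO {n m k : ℕ} (hmk : m ≤ k) {μ μ' : ℝ} (hμ : μ < μ') {p : PosVec k → CVec n}
    (hp : p ∈ powSpan n (expSet m k μ)) :
    compL p =O[atTop] fun t => iterLog m t ^ μ' := by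
  have hev := eventually_gt_atTop (iterExp k 0)
  refine powSpan_induction
    (motive := fun p => compL p =O[atTop] fun t => iterLog m t ^ μ') ?_ ?_ ?_ hp
  · refine (isBigO_zero _ _).congr' ?_ .rfl
    filter_upwards [hev] with t ht
    rw [compL_of_lt _ ht]
    rfl
  · intro p q hp hq
    refine (hp.add hq).congr' ?_ .rfl
    filter_upwards [hev] with t ht
    simp only [compL_of_lt _ ht, Pi.add_apply]
  · intro α hα v
    refine IsBigO.of_bound ‖v‖ ?_
    filter_upwards [hev, eventually_iterLog_pos m, eventually_iterLog_pos (m + 1),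
      (sum_exponent_isLittleO hmk hα).bound (sub_pos.2 hμ)] with t ht h1 h2 h3
    rw [compL_of_lt _ ht, norm_smul, norm_vecPow_lhat, Real.norm_of_nonneg (by positivity),
      iterLog_rpow_eq_exp _ _ h1, mul_comm]
    gcongr
    rw [Real.norm_of_nonneg h2.le] at h3
    have := (Real.le_norm_self _).trans h3
    linarith

theorem hasDerivAt_exponent {k : ℕ} {t : ℝ} (ht : iterExp k 0 < t) (α : Fin (k + 2) → ℂ) :
    HasDerivAt (fun t : ℝ => ∑ i : Fin (k + 2), (iterLog i t : ℂ) * α i)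
      (α 0 + ∑ j : Fin (k + 1),
        (∏ i ∈ Finset.Iic j, (((lhat k t ht i.succ : ℝ) : ℂ))⁻¹) * α j.succ) t := by
  simp_rw [Fin.sum_univ_succ (n := k + 1)]
  refine HasDerivAt.add ?_ (HasDerivAt.fun_sum fun j _ => ?_)
  · have := (hasDerivAt_iterLog_zero t).ofReal_comp.mul_const (α 0)
    simpa using this
  · have hj := hasDerivAt_iterLog_succ (j := j)
      ((iterExp_mono (by omega : (j : ℕ) ≤ k) 0).trans_lt ht)
    have h := hj.ofReal_comp.mul_const (α j.succ)
    have hprod : ∏ i ∈ Finset.Iic j, (((lhat k t ht i.succ : ℝ) : ℂ))⁻¹ =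
        ((∏ i ∈ Finset.range (j + 1), (iterLog i t)⁻¹ : ℝ) : ℂ) := by
      have h1 : Finset.range ((j : ℕ) + 1) = (Finset.Iic j).map Fin.valEmbedding := by
        rw [Fin.map_valEmbedding_Iic]
        ext x
        simp
      rw [h1, Finset.prod_map]
      push_cast
      rfl
    rw [hprod]
    simpa using h

/-- The chain rule on `exp(∑ α_i L_i)`: `L_0' = 1` produces `ℳ_{-1}`, and `L_{j+1}' = 1/(L_0 ⋯ L_j)`
produces `ℛ`. -/
theorem hasDerivAt_compL {n k : ℕ} {E : Set (Fin (k + 2) → ℂ)} {p : PosVec k → CVec n}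
    (hp : p ∈ powSpan n E) {t : ℝ} (ht : iterExp k 0 < t) :
    HasDerivAt (compL p) (compL (opM 0 p + opR p) t) t := by
  obtain ⟨ξ, -, rfl⟩ := mem_powSpan.1 hp
  have h1 : ∀ α, HasDerivAt (fun t : ℝ =>
      Complex.exp (∑ i : Fin (k + 2), (iterLog i t : ℂ) * α i) • ξ α)
      ((vecPow (lhat k t ht) α * (α 0 + ∑ j : Fin (k + 1),
        (∏ i ∈ Finset.Iic j, (((lhat k t ht i.succ : ℝ) : ℂ))⁻¹) * α j.succ)) • ξ α) t := by
    intro α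
    rw [vecPow_lhat]
    exact ((hasDerivAt_exponent ht α).cexp).smul_const _
  have h2 := HasDerivAt.fun_sum (u := ξ.support) fun α _ => h1 α
  have h3 : compL (powerSum ξ) =ᶠ[𝓝 t] fun t => ∑ α ∈ ξ.support,
      Complex.exp (∑ i : Fin (k + 2), (iterLog i t : ℂ) * α i) • ξ α := by
    filter_upwards [lt_mem_nhds ht] with s hs
    rw [compL_of_lt _ hs, powerSum, Finsupp.sum]
    exact Finset.sum_congr rfl fun α _ => by rw [vecPow_lhat]
  refine (h2.congr_of_eventuallyEq h3).congr_deriv ?_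
  rw [compL_of_lt _ ht, Pi.add_apply, opR]
  simp only [opM, coeffs_powerSum, Finsupp.sum, Finset.smul_sum]
  rw [Finset.sum_comm, ← Finset.sum_add_distrib]
  refine Finset.sum_congr rfl fun α _ => ?_
  simp only [smul_smul, ← Finset.sum_smul, ← add_smul]
  congr 1
  rw [mul_add, Finset.mul_sum]
  congr 1
  · ring
  · exact Finset.sum_congr rfl fun j _ => by ring

theorem compL_embedP {n a b : ℕ} (hab : a ≤ b) (p : PosVec a → CVec n) {t : ℝ}
    (ht : iterExp b 0 < t) : compL (embedP a b p) t = compL p t := by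
  rw [compL_of_lt _ ht, compL_of_lt _ ((iterExp_mono hab 0).trans_lt ht), embedP]
  congr 1
  funext i
  have : (i : ℕ) < b + 2 := by omega
  rw [dif_pos this]
  rfl

/-! ### Remainders -/

/-- The function `h` is `O(L_m^{-μ})` for some `μ > γ`. -/
def DecaysBeyond {n : ℕ} (m : ℕ) (γ : ℝ) (h : ℝ → CVec n) : Prop :=
  ∃ μ : ℝ, γ < μ ∧ h =O[atTop] fun t => iterLog m t ^ (-μ)

theorem DecaysBeyond.congr {n m : ℕ} {γ : ℝ} {g h : ℝ → CVec n} (hg : DecaysBeyond m γ g)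
    (hgh : g =ᶠ[atTop] h) : DecaysBeyond m γ h := by
  obtain ⟨μ, h1, h2⟩ := hg
  exact ⟨μ, h1, h2.congr' hgh .rfl⟩

theorem DecaysBeyond.add {n m : ℕ} {γ : ℝ} {g h : ℝ → CVec n} (hg : DecaysBeyond m γ g)
    (hh : DecaysBeyond m γ h) : DecaysBeyond m γ fun t => g t + h t := by
  obtain ⟨μ, h1, h2⟩ := hg
  obtain ⟨ν, h3, h4⟩ := hh
  refine ⟨min μ ν, lt_min h1 h3, IsBigO.add (h2.trans ?_) (h4.trans ?_)⟩
  · exact iterLog_rpow_isBigO m (neg_le_neg (min_le_left _ _))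
  · exact iterLog_rpow_isBigO m (neg_le_neg (min_le_right _ _))

theorem DecaysBeyond.neg {n m : ℕ} {γ : ℝ} {g : ℝ → CVec n} (hg : DecaysBeyond m γ g) :
    DecaysBeyond m γ fun t => -g t := by
  obtain ⟨μ, h1, h2⟩ := hg
  exact ⟨μ, h1, h2.neg_left⟩

theorem DecaysBeyond.sub {n m : ℕ} {γ : ℝ} {g h : ℝ → CVec n} (hg : DecaysBeyond m γ g)
    (hh : DecaysBeyond m γ h) : DecaysBeyond m γ fun t => g t - h t := by
  simpa [sub_eq_add_neg] using hg.add hh.neg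

theorem decaysBeyond_zero {n : ℕ} (m : ℕ) (γ : ℝ) : DecaysBeyond m γ (0 : ℝ → CVec n) :=
  ⟨γ + 1, by linarith, isBigO_zero _ _⟩

theorem DecaysBeyond.sum {n m : ℕ} {γ : ℝ} {ι : Type*} {s : Finset ι} {g : ι → ℝ → CVec n}
    (h : ∀ i ∈ s, DecaysBeyond m γ (g i)) : DecaysBeyond m γ fun t => ∑ i ∈ s, g i t := by
  have := Finset.sum_induction g (DecaysBeyond m γ) (fun _ _ h1 h2 => h1.add h2)
    (decaysBeyond_zero m γ) h
  refine this.congr (.of_forall fun t => ?_)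
  rw [Finset.sum_apply]

theorem decaysBeyond_compL {n m k : ℕ} (hmk : m ≤ k) {μ γ : ℝ} (hμ : γ < -μ)
    {p : PosVec k → CVec n} (hp : p ∈ powSpan n (expSet m k μ)) : DecaysBeyond m γ (compL p) :=
  -- The midpoint of `γ` and `-μ`.
  ⟨(γ - μ) / 2, by linarith, compL_isBigO hmk (by linarith) hp⟩

/-! ### The complexification as a continuous linear map -/

/-- The inclusion `ℝⁿ ⊂ ℂⁿ` as a real-linear map. -/
noncomputable def toCLin (n : ℕ) : RVec n →ₗ[ℝ] CVec n where
  toFun := toC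
  map_add' x y := by ext i; simp [toC]
  map_smul' c x := by ext i; simp [toC]

theorem toC_add {n : ℕ} (x y : RVec n) : toC (x + y) = toC x + toC y := (toCLin n).map_add x y

theorem toC_sub {n : ℕ} (x y : RVec n) : toC (x - y) = toC x - toC y := (toCLin n).map_sub x y

theorem toC_neg {n : ℕ} (x : RVec n) : toC (-x) = -toC x := (toCLin n).map_neg x

theorem toC_sum {n : ℕ} {ι : Type*} (s : Finset ι) (x : ι → RVec n) :
    toC (∑ i ∈ s, x i) = ∑ i ∈ s, toC (x i) := map_sum (toCLin n) x s

theorem norm_toC {n : ℕ} (x : RVec n) : ‖toC x‖ = ‖x‖ := by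
  simp [EuclideanSpace.norm_eq, toC]

theorem HasDerivAt.toC {n : ℕ} {y : ℝ → RVec n} {y' : RVec n} {t : ℝ} (h : HasDerivAt y y' t) :
    HasDerivAt (fun t => _root_.toC (y t)) (_root_.toC y') t :=
  (LinearMap.toContinuousLinearMap (toCLin n)).hasFDerivAt.comp_hasDerivAt t h

theorem toC_toEuclideanLin {n : ℕ} (A : Matrix (Fin n) (Fin n) ℝ) (x : RVec n) :
    toC (Matrix.toEuclideanLin A x) =
      Matrix.toEuclideanLin (A.map (algebraMap ℝ ℂ)) (toC x) := by
  ext i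
  simp [toC, Matrix.toEuclideanLin, Matrix.mulVec, dotProduct]

/-! ### Stability in the scale of iterated logarithms -/

/-- The threshold `ε` depends on `A` only, not on the level `m` or the rate `μ`; slow variation is
secured by starting late. -/
theorem exists_stability_iterLog {n : ℕ} (hn : 1 ≤ n) (A : Matrix (Fin n) (Fin n) ℂ)
    (hA : ∀ l ∈ spectrum ℂ A, 0 < l.re) :
    ∃ ε : ℝ, 0 < ε ∧ ∀ (m : ℕ) (μ : ℝ) (w h : ℝ → CVec n) (ρ : ℝ → ℝ), 0 < μ →
      (∀ᶠ t in atTop, HasDerivAt w (-(Matrix.toEuclideanLin A (w t)) + h t) t) →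
      (∀ᶠ t in atTop, ‖h t‖ ≤ ε * ‖w t‖ + ρ t) →
      (ρ =O[atTop] fun t => iterLog m t ^ (-μ)) → w =O[atTop] fun t => iterLog m t ^ (-μ) := by
  have : Nonempty (Fin n) := ⟨⟨0, hn⟩⟩
  have hB : ∀ l ∈ spectrum ℂ (Matrix.toEuclideanCLM (n := Fin n) (𝕜 := ℂ) A), 0 < l.re := by
    intro l hl
    rw [AlgEquiv.spectrum_eq] at hl
    exact hA l hl
  obtain ⟨C, a, hC, ha, hdec⟩ := exists_exp_decay _ hB
  obtain ⟨ε, hε, hstab⟩ := exists_stability _ hC ha hdec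
  refine ⟨ε, hε, ?_⟩
  intro m μ w h ρ hμ hw hh hρ
  obtain ⟨K, hK, hρK⟩ := hρ.exists_nonneg
  obtain ⟨T, ⟨hpos, hcont, hslow⟩, hT⟩ := ((exists_iterLog_rpow_slow m hμ (half_pos ha)).and
    (eventually_forall_ge_atTop.2 (hw.and (hh.and hρK.bound)))).exists
  have hφ : ∀ t, T ≤ t → 0 < iterLog m t ^ (-μ) := fun t ht => Real.rpow_pos_of_pos (hpos t ht) _
  obtain ⟨M, hM⟩ := hstab w h (fun t => iterLog m t ^ (-μ)) K T hK (fun t ht => (hT t ht).1)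
    (fun t ht => by
      obtain ⟨-, h1, h2⟩ := hT t ht
      rw [Real.norm_of_nonneg (hφ t ht).le] at h2
      linarith [Real.le_norm_self (ρ t)]) hφ hcont hslow
  refine IsBigO.of_bound M ?_
  filter_upwards [eventually_ge_atTop T] with t ht
  rw [Real.norm_of_nonneg (hφ t ht).le]
  exact hM t ht

/-! ### The polynomial part of the nonlinearity -/

/-- The polynomial map `z ↦ ∑_{r=2}^M 𝒢_r(z, …, z)` of `ℂⁿ`. -/
noncomputable def polyPart {n : ℕ}
    (𝒢 : (r : ℕ) → MultilinearMap ℝ (fun _ : Fin r => RVec n) (RVec n)) (M : ℕ) (z : CVec n) :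
    CVec n :=
  ∑ r ∈ Finset.Icc 2 M, complexify (𝒢 r) fun _ => z

/-- With at least two factors, each term of the product rule keeps a factor vanishing at `0`. Strict
differentiability is what yields the two-point Lipschitz bound. -/
theorem hasStrictFDerivAt_complexify_zero {n r : ℕ} (hr : 2 ≤ r)
    (M : MultilinearMap ℝ (fun _ : Fin r => RVec n) (RVec n)) :
    HasStrictFDerivAt (fun z : CVec n => complexify M fun _ => z) (0 : CVec n →L[ℂ] CVec n) 0 := by
  have h1 : ∀ J : Fin r → Fin n, HasStrictFDerivAt
      (fun z : CVec n => (∏ i, z (J i)) • toC (M fun i => EuclideanSpace.single (J i) 1))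
      (0 : CVec n →L[ℂ] CVec n) 0 := by
    intro J
    have h2 := HasStrictFDerivAt.finsetProd (u := Finset.univ) (x := (0 : CVec n))
      (g := fun (i : Fin r) (z : CVec n) => z (J i))
      (fun i _ => (EuclideanSpace.proj (𝕜 := ℂ) (J i) : CVec n →L[ℂ] ℂ).hasStrictFDerivAt)
    have h3 : ∀ i : Fin r, ∏ j ∈ Finset.univ.erase i, (0 : CVec n) (J j) = 0 := by
      intro i
      have : Nontrivial (Fin r) := Fin.nontrivial_iff_two_le.2 hr
      obtain ⟨j, hj⟩ := exists_ne i
      exact Finset.prod_eq_zero (Finset.mem_erase.2 ⟨hj, Finset.mem_univ j⟩) (by simp)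
    have h4 := h2.smul_const (toC (M fun i => EuclideanSpace.single (J i) 1))
    refine h4.congr_fderiv ?_
    simp only [h3]
    ext z
    simp
  have h5 := HasStrictFDerivAt.fun_sum (u := Finset.univ) fun J _ => h1 J
  refine h5.congr_fderiv ?_
  simp

theorem polyPart_lipschitz {n : ℕ}
    (𝒢 : (r : ℕ) → MultilinearMap ℝ (fun _ : Fin r => RVec n) (RVec n)) (M : ℕ) {ε : ℝ}
    (hε : 0 < ε) :
    ∀ᶠ z : CVec n × CVec n in 𝓝 (0, 0),
      ‖polyPart 𝒢 M z.1 - polyPart 𝒢 M z.2‖ ≤ ε * ‖z.1 - z.2‖ := by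
  have h : HasStrictFDerivAt (polyPart 𝒢 M) (0 : CVec n →L[ℂ] CVec n) 0 := by
    have := HasStrictFDerivAt.fun_sum (u := Finset.Icc 2 M) fun r hr =>
      hasStrictFDerivAt_complexify_zero (Finset.mem_Icc.1 hr).1 (𝒢 r)
    refine this.congr_fderiv ?_
    simp
  simpa using h.isLittleO.bound hε

theorem polyPart_zero {n : ℕ}
    (𝒢 : (r : ℕ) → MultilinearMap ℝ (fun _ : Fin r => RVec n) (RVec n)) (M : ℕ) :
    polyPart 𝒢 M 0 = 0 := by
  refine Finset.sum_eq_zero fun r hr => Finset.sum_eq_zero fun J _ => ?_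
  have h2 := (Finset.mem_Icc.1 hr).1
  rw [Finset.prod_eq_zero (Finset.mem_univ (⟨0, by omega⟩ : Fin r)) (by simp), zero_smul]

theorem polyPart_toC {n : ℕ}
    {𝒢 : (r : ℕ) → MultilinearMap ℝ (fun _ : Fin r => RVec n) (RVec n)}
    {Gm : ℕ → RVec n → RVec n} (h𝒢 : ∀ r, 2 ≤ r → ∀ x, Gm r x = 𝒢 r fun _ => x) (M : ℕ)
    (x : RVec n) : polyPart 𝒢 M (toC x) = toC (∑ r ∈ Finset.Icc 2 M, Gm r x) := by
  rw [toC_sum]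
  refine Finset.sum_congr rfl fun r hr => ?_
  rw [complexify_toC, h𝒢 r (Finset.mem_Icc.1 hr).1]

theorem complexify_sum {n r : ℕ} {ι : Type*} [DecidableEq ι]
    (M : MultilinearMap ℝ (fun _ : Fin r => RVec n) (RVec n)) (s : Finset ι) (x : ι → CVec n) :
    complexify M (fun _ => ∑ k ∈ s, x k) =
      ∑ J ∈ Fintype.piFinset fun _ : Fin r => s, complexify M fun i => x (J i) := by
  simp only [complexify]
  rw [Finset.sum_comm]
  refine Finset.sum_congr rfl fun I _ => ?_
  rw [← Finset.sum_smul, ← Finset.prod_univ_sum (fun _ => s) fun i k => x k (I i)]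
  simp

/-! ### Index tuples -/

/-- All `(r; j_1, …, j_r)` with `2 ≤ r ≤ M` and `j_i ≤ N`. -/
def boundedTuples (M N : ℕ) : Finset (Σ r : ℕ, (Fin r → ℕ)) :=
  (Finset.Icc 2 M).sigma fun _ => Fintype.piFinset fun _ => Finset.range (N + 1)

theorem polyPart_sum {n : ℕ}
    (𝒢 : (r : ℕ) → MultilinearMap ℝ (fun _ : Fin r => RVec n) (RVec n)) (M N : ℕ)
    (x : ℕ → CVec n) : polyPart 𝒢 M (∑ k ∈ Finset.range (N + 1), x k) =
      ∑ J ∈ boundedTuples M N, complexify (𝒢 J.1) fun i => x (J.2 i) := by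
  rw [boundedTuples, Finset.sum_sigma]
  exact Finset.sum_congr rfl fun r _ => complexify_sum _ _ _

/-- A sum of at least two positive numbers exceeds each of them. This makes the recursion causal. -/
theorem lt_of_mem_tupleSet {μ : ℕ → ℝ} (hmono : StrictMono μ) (hpos : ∀ k, 0 < μ k)
    {k : ℕ} {J : Σ r : ℕ, (Fin r → ℕ)} (hJ : J ∈ tupleSet μ k)
    (i : Fin J.1) : J.2 i < k := by
  obtain ⟨h2, hsum⟩ := hJ
  rw [← hmono.lt_iff_lt, ← hsum]
  have : Nontrivial (Fin J.1) := Fin.nontrivial_iff_two_le.2 h2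
  obtain ⟨j, hj⟩ := exists_ne i
  exact Finset.single_lt_sum hj (Finset.mem_univ i) (Finset.mem_univ j) (hpos _)
    fun _ _ _ => (hpos _).le

/-- The length is bounded because `r μ_0 ≤ μ_k ≤ M μ_0`. -/
theorem tupleSet_subset {μ : ℕ → ℝ} (hmono : StrictMono μ) (hpos : ∀ k, 0 < μ k)
    {M N k : ℕ} (hk : k ≤ N) (hM : μ N ≤ M * μ 0) :
    tupleSet μ k ⊆ boundedTuples M N := by
  intro J hJ
  have hlt := lt_of_mem_tupleSet hmono hpos hJ
  obtain ⟨h2, hsum⟩ := hJ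
  refine Finset.mem_coe.2 (Finset.mem_sigma.2 ⟨Finset.mem_Icc.2 ⟨h2, ?_⟩, ?_⟩)
  · have h1 : (J.1 : ℝ) * μ 0 ≤ M * μ 0 := by
      calc (J.1 : ℝ) * μ 0 = ∑ _i : Fin J.1, μ 0 := by simp
        _ ≤ ∑ i, μ (J.2 i) := Finset.sum_le_sum fun i _ => hmono.monotone (Nat.zero_le _)
        _ = μ k := hsum
        _ ≤ μ N := hmono.monotone hk
        _ ≤ _ := hM
    exact_mod_cast le_of_mul_le_mul_right h1 (hpos 0)
  · exact Fintype.mem_piFinset.2 fun i => Finset.mem_range.2 (by have := hlt i; omega)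

theorem nonlinTerm_apply {μ : ℕ → ℝ} (hmono : StrictMono μ) (hpos : ∀ k, 0 < μ k)
    {n : ℕ}
    (𝒢 : (m : ℕ) → MultilinearMap ℝ (fun _ : Fin m => RVec n) (RVec n)) (ν : ℕ → ℕ)
    (q : (k : ℕ) → PosVec (ν k) → CVec n) {M N k : ℕ} (hk : k ≤ N) (hM : μ N ≤ M * μ 0) :
    open Classical in
    nonlinTerm 𝒢 μ ν q k = ∑ J ∈ (boundedTuples M N).filter (· ∈ tupleSet μ k),
      fun z => complexify (𝒢 J.1) fun i => embedP (ν (J.2 i)) (ν k) (q (J.2 i)) z := by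
  classical
  funext z
  rw [Finset.sum_apply, nonlinTerm, ← finsum_mem_coe_finset]
  congr 1
  funext J
  have : J ∈ tupleSet μ k ↔
      J ∈ ((((boundedTuples M N).filter (· ∈ tupleSet μ k)) : Finset _) : Set _) := by
    rw [Finset.mem_coe, Finset.mem_filter]
    exact ⟨fun h => ⟨tupleSet_subset hmono hpos hk hM h, h⟩, fun h => h.2⟩
  rw [this]

theorem nonlinTerm_congr {μ : ℕ → ℝ} (hmono : StrictMono μ) (hpos : ∀ k, 0 < μ k)
    {n : ℕ}
    (𝒢 : (m : ℕ) → MultilinearMap ℝ (fun _ : Fin m => RVec n) (RVec n)) (ν : ℕ → ℕ)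
    (k : ℕ) (q q' : (k : ℕ) → PosVec (ν k) → CVec n) (h : ∀ j < k, q j = q' j) :
    nonlinTerm 𝒢 μ ν q k = nonlinTerm 𝒢 μ ν q' k := by
  funext z
  refine finsum_mem_congr rfl fun J hJ => ?_
  congr 1
  funext i
  rw [h _ (lt_of_mem_tupleSet hmono hpos hJ i)]

theorem exists_nat_mul_ge {μ : ℕ → ℝ} (hpos : ∀ k, 0 < μ k)
    (N : ℕ) : ∃ M : ℕ, 2 ≤ M ∧ μ N ≤ M * μ 0 := by
  obtain ⟨M, hM⟩ := exists_nat_ge (μ N / μ 0)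
  refine ⟨max 2 M, le_max_left _ _, ((div_le_iff₀ (hpos 0)).1 hM).trans ?_⟩
  have : (M : ℝ) ≤ (max 2 M : ℕ) := by exact_mod_cast le_max_right _ _
  exact mul_le_mul_of_nonneg_right this (hpos 0).le

theorem nonlinTerm_mem_classP {μ : ℕ → ℝ} (hmono : StrictMono μ) (hpos : ∀ k, 0 < μ k)
    {n m : ℕ}
    (𝒢 : (m : ℕ) → MultilinearMap ℝ (fun _ : Fin m => RVec n) (RVec n)) {ν : ℕ → ℕ}
    (hν : Monotone ν) (hm : ∀ k, m ≤ ν k) (k : ℕ) {q : (k : ℕ) → PosVec (ν k) → CVec n}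
    (hq : ∀ j < k, q j ∈ ClassP n m (ν j) (-μ j)) :
    nonlinTerm 𝒢 μ ν q k ∈ ClassP n m (ν k) (-μ k) := by
  classical
  obtain ⟨M, -, hM⟩ := exists_nat_mul_ge hpos k
  rw [nonlinTerm_apply hmono hpos 𝒢 ν q le_rfl hM]
  refine ClassP.sum fun J hJ => ?_
  have hJ := (Finset.mem_filter.1 hJ).2
  have hlt := lt_of_mem_tupleSet hmono hpos hJ
  rw [← hJ.2, ← Finset.sum_neg_distrib]
  exact ClassP.complexify (𝒢 J.1) fun i => ClassP.embedP (hm _) (hν (hlt i).le) (hq _ (hlt i))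

theorem sum_mem_range {μ : ℕ → ℝ}
    (hadd : ∀ a ∈ range μ, ∀ b ∈ range μ, a + b ∈ range μ) {r : ℕ} (hr : 1 ≤ r)
    (J : Fin r → ℕ) : ∑ i, μ (J i) ∈ range μ := by
  have : Nonempty (Fin r) := ⟨⟨0, hr⟩⟩
  exact Finset.sum_induction_nonempty (fun i => μ (J i)) (· ∈ range μ)
    (fun a b ha hb => hadd a ha b hb) Finset.univ_nonempty fun i _ => ⟨_, rfl⟩

theorem compL_nonlinTerm {μ : ℕ → ℝ} (hmono : StrictMono μ) (hpos : ∀ k, 0 < μ k)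
    {n : ℕ}
    (𝒢 : (m : ℕ) → MultilinearMap ℝ (fun _ : Fin m => RVec n) (RVec n)) {ν : ℕ → ℕ}
    (hν : Monotone ν) (q : (k : ℕ) → PosVec (ν k) → CVec n) {M N k : ℕ} (hk : k ≤ N)
    (hM : μ N ≤ M * μ 0) {t : ℝ} (ht : iterExp (ν k) 0 < t) :
    open Classical in
    compL (nonlinTerm 𝒢 μ ν q k) t = ∑ J ∈ boundedTuples M N,
      if ∑ i, μ (J.2 i) = μ k then complexify (𝒢 J.1) fun i => compL (q (J.2 i)) t else 0 := by
  classical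
  rw [compL_of_lt _ ht, nonlinTerm_apply hmono hpos 𝒢 ν q hk hM, Finset.sum_apply,
    Finset.sum_filter]
  refine Finset.sum_congr rfl fun J hJ => ?_
  have h2 : 2 ≤ J.1 := (Finset.mem_Icc.1 (Finset.mem_sigma.1 hJ).1).1
  have hiff : J ∈ tupleSet μ k ↔ ∑ i, μ (J.2 i) = μ k := and_iff_right h2
  by_cases h : J ∈ tupleSet μ k
  · rw [if_pos h, if_pos (hiff.1 h)]
    congr 1
    funext i
    rw [← compL_embedP (hν (lt_of_mem_tupleSet hmono hpos h i).le) _ ht, compL_of_lt _ ht]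
  · rw [if_neg h, if_neg fun h' => h (hiff.2 h')]

theorem sum_compL_nonlinTerm {μ : ℕ → ℝ} (hmono : StrictMono μ) (hpos : ∀ k, 0 < μ k)
    {n : ℕ}
    (𝒢 : (m : ℕ) → MultilinearMap ℝ (fun _ : Fin m => RVec n) (RVec n)) {ν : ℕ → ℕ}
    (hν : Monotone ν) (hadd : ∀ a ∈ range μ, ∀ b ∈ range μ, a + b ∈ range μ)
    (q : (k : ℕ) → PosVec (ν k) → CVec n) {M N : ℕ}
    (hM : μ N ≤ M * μ 0) {t : ℝ} (ht : iterExp (ν N) 0 < t) :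
    open Classical in
    ∑ k ∈ Finset.range (N + 1), compL (nonlinTerm 𝒢 μ ν q k) t = ∑ J ∈ boundedTuples M N,
      if ∑ i, μ (J.2 i) ≤ μ N then complexify (𝒢 J.1) fun i => compL (q (J.2 i)) t else 0 := by
  classical
  rw [Finset.sum_congr rfl fun k hk => compL_nonlinTerm hmono hpos 𝒢 hν q
    (Nat.lt_succ_iff.1 (Finset.mem_range.1 hk)) hM ((iterExp_mono
      (hν (Nat.lt_succ_iff.1 (Finset.mem_range.1 hk))) 0).trans_lt ht), Finset.sum_comm]
  refine Finset.sum_congr rfl fun J hJ => ?_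
  have h2 : 2 ≤ J.1 := (Finset.mem_Icc.1 (Finset.mem_sigma.1 hJ).1).1
  -- Closure under addition: each tuple is counted at exactly one index `l`, so the inner sum
  -- collapses to the condition `l ≤ N`.
  obtain ⟨l, hl⟩ := sum_mem_range hadd (by omega) J.2
  simp only [← hl, hmono.injective.eq_iff, hmono.le_iff_le]
  rw [Finset.sum_ite_eq]
  simp

/-- Multilinear expansion leaves only the finitely many tuples whose exponents sum to more than `μ
N`, and each of these decays beyond `μ N`. -/
theorem decaysBeyond_polyPart_sub {μ : ℕ → ℝ} (hmono : StrictMono μ) (hpos : ∀ k, 0 < μ k)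
    {n m : ℕ}
    (𝒢 : (m : ℕ) → MultilinearMap ℝ (fun _ : Fin m => RVec n) (RVec n)) {ν : ℕ → ℕ}
    (hν : Monotone ν) (hm : ∀ k, m ≤ ν k)
    (hadd : ∀ a ∈ range μ, ∀ b ∈ range μ, a + b ∈ range μ)
    {q : (k : ℕ) → PosVec (ν k) → CVec n} (hq : ∀ k, q k ∈ ClassP n m (ν k) (-μ k)) {M N : ℕ}
    (hM : μ N ≤ M * μ 0) :
    DecaysBeyond m (μ N) fun t =>
      polyPart 𝒢 M (∑ k ∈ Finset.range (N + 1), compL (q k) t) -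
        ∑ k ∈ Finset.range (N + 1), compL (nonlinTerm 𝒢 μ ν q k) t := by
  classical
  have h1 : DecaysBeyond m (μ N) fun t => ∑ J ∈ boundedTuples M N,
      if ∑ i, μ (J.2 i) ≤ μ N then 0 else complexify (𝒢 J.1) fun i => compL (q (J.2 i)) t := by
    refine DecaysBeyond.sum fun J hJ => ?_
    by_cases h : ∑ i, μ (J.2 i) ≤ μ N
    · simp only [if_pos h]
      exact decaysBeyond_zero m _
    · simp only [if_neg h]
      have hle : ∀ i, J.2 i ≤ N := fun i => Nat.lt_succ_iff.1
        (Finset.mem_range.1 (Fintype.mem_piFinset.1 (Finset.mem_sigma.1 hJ).2 i))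
      have h3 := complexify_mem_powSpan (𝒢 J.1) fun i =>
        embedP_mem_powSpan (hm _) (hν (hle i)) (mem_classP_iff.1 (hq (J.2 i))).1
      refine (decaysBeyond_compL (hm N) (γ := μ N) ?_ h3).congr ?_
      · rw [Finset.sum_neg_distrib, neg_neg]
        exact not_le.1 h
      · filter_upwards [eventually_gt_atTop (iterExp (ν N) 0)] with t ht
        rw [compL_of_lt _ ht]
        congr 1
        funext i
        rw [← compL_embedP (hν (hle i)) _ ht, compL_of_lt _ ht]
  refine h1.congr ?_
  filter_upwards [eventually_gt_atTop (iterExp (ν N) 0)] with t ht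
  rw [polyPart_sum, sum_compL_nonlinTerm hmono hpos 𝒢 hν hadd q hM ht, ← Finset.sum_sub_distrib]
  refine Finset.sum_congr rfl fun J _ => ?_
  split_ifs <;> simp

/-! ### The term `χ_k` -/

theorem chiTerm_of_eq {n : ℕ} {μ : ℕ → ℝ} (hmono : StrictMono μ) {ν : ℕ → ℕ}
    (q : (k : ℕ) → PosVec (ν k) → CVec n) {k l : ℕ} (hl : μ l + 1 = μ k) :
    chiTerm μ ν q k = embedP (ν l) (ν k) (opR (q l)) := by
  have h : ∃ l, l < k ∧ μ l + 1 = μ k := ⟨l, hmono.lt_iff_lt.1 (by linarith), hl⟩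
  have hc : h.choose = l := hmono.injective (by linarith [h.choose_spec.2])
  rw [chiTerm, dif_pos h, hc]

theorem chiTerm_of_forall_ne {n : ℕ} {μ : ℕ → ℝ} {ν : ℕ → ℕ}
    (q : (k : ℕ) → PosVec (ν k) → CVec n) {k : ℕ} (h : ∀ l, μ l + 1 ≠ μ k) :
    chiTerm μ ν q k = 0 := by
  rw [chiTerm, dif_neg fun ⟨l, _, hl⟩ => h l hl]

theorem chiTerm_congr {n : ℕ} {μ : ℕ → ℝ} {ν : ℕ → ℕ} (k : ℕ)
    (q q' : (k : ℕ) → PosVec (ν k) → CVec n) (h : ∀ j < k, q j = q' j) :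
    chiTerm μ ν q k = chiTerm μ ν q' k := by
  rw [chiTerm, chiTerm]
  split_ifs with hex
  · rw [h _ hex.choose_spec.1]
  · rfl

theorem chiTerm_mem_classP {n : ℕ} {μ : ℕ → ℝ} (hmono : StrictMono μ) {ν : ℕ → ℕ}
    (hν : Monotone ν) (k : ℕ) {q : (k : ℕ) → PosVec (ν k) → CVec n}
    (hq : ∀ j < k, q j ∈ ClassP n 0 (ν j) (-μ j)) :
    chiTerm μ ν q k ∈ ClassP n 0 (ν k) (-μ k) := by
  by_cases h : ∃ l, μ l + 1 = μ k
  · obtain ⟨l, hl⟩ := h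
    have hlk : l < k := hmono.lt_iff_lt.1 (by linarith)
    rw [chiTerm_of_eq hmono q hl]
    have h1 := ClassP.opR (hq l hlk)
    rw [show -μ l - 1 = -μ k by linarith] at h1
    exact ClassP.embedP (Nat.zero_le _) (hν hlk.le) h1
  · push Not at h
    rw [chiTerm_of_forall_ne q h]
    exact ClassP.zero

/-- Closure under `x ↦ x + 1` makes each `ℛ q_l` equal to one `χ_k`. Those with `μ l + 1 ≤ μ N`
cancel within the sum; the others decay beyond `μ N`. -/
theorem decaysBeyond_opR_sub_chiTerm {n : ℕ} {μ : ℕ → ℝ} (hmono : StrictMono μ) {ν : ℕ → ℕ}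
    (hν : Monotone ν) (hone : ∀ a ∈ range μ, a + 1 ∈ range μ)
    {q : (k : ℕ) → PosVec (ν k) → CVec n} (hq : ∀ k, q k ∈ ClassP n 0 (ν k) (-μ k)) (N : ℕ) :
    DecaysBeyond 0 (μ N) fun t => ∑ k ∈ Finset.range (N + 1),
      (compL (opR (q k)) t - compL (chiTerm μ ν q k) t) := by
  classical
  have h1 : DecaysBeyond 0 (μ N) fun t => ∑ l ∈ Finset.range (N + 1),
      if μ l + 1 ≤ μ N then 0 else compL (opR (q l)) t := by
    refine DecaysBeyond.sum fun l _ => ?_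
    by_cases h : μ l + 1 ≤ μ N
    · simp only [if_pos h]
      exact decaysBeyond_zero 0 _
    · simp only [if_neg h]
      exact decaysBeyond_compL (Nat.zero_le _) (by linarith)
        (opR_mem_powSpan (mem_classP_iff.1 (hq l)).1)
  refine h1.congr ?_
  filter_upwards [eventually_gt_atTop (iterExp (ν N) 0)] with t ht
  have hchi : ∀ k ∈ Finset.range (N + 1), compL (chiTerm μ ν q k) t =
      ∑ l ∈ Finset.range (N + 1), if μ l + 1 = μ k then compL (opR (q l)) t else 0 := by
    intro k hk
    have hkN : k ≤ N := Nat.lt_succ_iff.1 (Finset.mem_range.1 hk)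
    have htk : iterExp (ν k) 0 < t := (iterExp_mono (hν hkN) 0).trans_lt ht
    by_cases h : ∃ l, μ l + 1 = μ k
    · obtain ⟨l, hl⟩ := h
      have hlk : l < k := hmono.lt_iff_lt.1 (by linarith)
      rw [chiTerm_of_eq hmono q hl, compL_embedP (hν hlk.le) _ htk, Finset.sum_eq_single l]
      · rw [if_pos hl]
      · intro j _ hj
        rw [if_neg fun h => hj (hmono.injective (by linarith))]
      · intro h
        exact absurd (Finset.mem_range.2 (by omega)) h
    · push Not at h
      rw [chiTerm_of_forall_ne q h, compL_of_lt _ htk, Finset.sum_eq_zero fun l _ => if_neg (h l)]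
      rfl
  rw [Finset.sum_sub_distrib, Finset.sum_congr rfl hchi, Finset.sum_comm,
    ← Finset.sum_sub_distrib]
  refine Finset.sum_congr rfl fun l _ => ?_
  obtain ⟨j, hj⟩ := hone (μ l) ⟨l, rfl⟩
  simp only [← hj, hmono.injective.eq_iff, hmono.le_iff_le]
  rw [Finset.sum_ite_eq]
  simp only [Finset.mem_range, Nat.lt_succ_iff]
  split_ifs <;> simp

theorem decaysBeyond_opR {n m k : ℕ} (hm : 1 ≤ m) {μ γ : ℝ} {p : PosVec k → CVec n}
    (hp : p ∈ powSpan n (expSet m k μ)) : DecaysBeyond m γ (compL (opR p)) := by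
  -- Since `m ≥ 1`, the exponents of both `e^t` and `t` are purely imaginary, so `ℛ p` has order
  -- `t⁻¹` up to powers of logarithms; half a power of `t` absorbs those.
  have hsub : expSet m k μ ⊆ expSet 0 k 0 := fun α hα i =>
    ⟨fun h => (hα i).1 (by omega), fun h => (hα i).1 (by omega)⟩
  have h1 := opR_mem_powSpan (powSpan_mono hsub hp)
  have h2 := compL_isBigO (Nat.zero_le k) (μ' := -(1 / 2)) (by norm_num) h1
  exact ⟨γ + 1, by linarith, h2.trans (rpow_isBigO_iterLog_rpow hm (by norm_num) _)⟩

/-! ### Formal solutions -/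

section FormalSolutions

variable {n : ℕ}

theorem formal_solution_mem_classP {m : ℕ} {A : Matrix (Fin n) (Fin n) ℝ} {μ : ℕ → ℝ}
    (hmono : StrictMono μ) (hpos : ∀ k, 0 < μ k) {ν : ℕ → ℕ} (hν : Monotone ν)
    (hm : ∀ k, m ≤ ν k)
    {X : ((k : ℕ) → PosVec (ν k) → CVec n) → (k : ℕ) → PosVec (ν k) → CVec n}
    (hX : ∀ q k, (∀ j < k, q j ∈ ClassP n m (ν j) (-μ j)) → X q k ∈ ClassP n m (ν k) (-μ k))
    (𝒢 : (r : ℕ) → MultilinearMap ℝ (fun _ : Fin r => RVec n) (RVec n))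
    {p q : (k : ℕ) → PosVec (ν k) → CVec n} (hp : ∀ k, p k ∈ ClassP n m (ν k) (-μ k))
    (hq : ∀ k, q k = opZ (A.map (algebraMap ℝ ℂ)) (nonlinTerm 𝒢 μ ν q k + p k - X q k)) (k : ℕ) :
    q k ∈ ClassP n m (ν k) (-μ k) := by
  induction k using Nat.strong_induction_on with
  | _ k ih =>
    rw [hq k]
    exact ClassP.opZ A (ClassP.sub (ClassP.add (nonlinTerm_mem_classP hmono hpos 𝒢 hν hm k ih)
      (hp k)) (hX q k ih))

/-- The partial sums of a formal solution solve the equation up to a small remainder. -/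
theorem exists_residual {m : ℕ} {A : Matrix (Fin n) (Fin n) ℝ}
    (hA : ∀ l ∈ spectrum ℂ (A.map (algebraMap ℝ ℂ)), 0 < l.re) {μ : ℕ → ℝ}
    (hmono : StrictMono μ) (hpos : ∀ k, 0 < μ k) {ν : ℕ → ℕ} (hν : Monotone ν)
    (hm : ∀ k, m ≤ ν k) (hadd : ∀ a ∈ range μ, ∀ b ∈ range μ, a + b ∈ range μ)
    {X : ((k : ℕ) → PosVec (ν k) → CVec n) → (k : ℕ) → PosVec (ν k) → CVec n}
    (hX : ∀ q k, (∀ j < k, q j ∈ ClassP n m (ν j) (-μ j)) → X q k ∈ ClassP n m (ν k) (-μ k))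
    (hXR : ∀ q, (∀ k, q k ∈ ClassP n m (ν k) (-μ k)) → ∀ N, DecaysBeyond m (μ N) fun t =>
      ∑ k ∈ Finset.range (N + 1), (compL (opR (q k)) t - compL (X q k) t))
    (𝒢 : (r : ℕ) → MultilinearMap ℝ (fun _ : Fin r => RVec n) (RVec n))
    {p q : (k : ℕ) → PosVec (ν k) → CVec n} (hp : ∀ k, p k ∈ ClassP n m (ν k) (-μ k))
    {f : ℝ → CVec n} (hf : LExpansion m μ f fun k => compL (p k))
    (hq : ∀ k, q k = opZ (A.map (algebraMap ℝ ℂ)) (nonlinTerm 𝒢 μ ν q k + p k - X q k))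
    {M N : ℕ} (hM : μ N ≤ M * μ 0) :
    ∃ ρ : ℝ → CVec n, DecaysBeyond m (μ N) ρ ∧ ∀ᶠ t in atTop,
      HasDerivAt (fun t => ∑ k ∈ Finset.range (N + 1), compL (q k) t)
        (-(Matrix.toEuclideanLin (A.map (algebraMap ℝ ℂ))
            (∑ k ∈ Finset.range (N + 1), compL (q k) t)) +
          polyPart 𝒢 M (∑ k ∈ Finset.range (N + 1), compL (q k) t) + f t + ρ t) t := by
  have hqP := formal_solution_mem_classP hmono hpos hν hm hX 𝒢 hp hq
  -- The remainder combines the mismatch between `ℛ` and `X`, the tail of the forcing and the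
  -- surplus products of the polynomial part.
  refine ⟨_, ((hXR q hqP N).sub (hf N)).sub
    (decaysBeyond_polyPart_sub hmono hpos 𝒢 hν hm hadd hqP hM), ?_⟩
  filter_upwards [eventually_gt_atTop (iterExp (ν N) 0)] with t ht
  have hk : ∀ k ∈ Finset.range (N + 1), iterExp (ν k) 0 < t := fun k hk =>
    (iterExp_mono (hν (Nat.lt_succ_iff.1 (Finset.mem_range.1 hk))) 0).trans_lt ht
  refine (HasDerivAt.fun_sum fun k hkN =>
    hasDerivAt_compL (mem_classP_iff.1 (hqP k)).1 (hk k hkN)).congr_deriv ?_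
  have key : ∀ k ∈ Finset.range (N + 1), compL (opM 0 (q k) + opR (q k)) t =
      -(Matrix.toEuclideanLin (A.map (algebraMap ℝ ℂ)) (compL (q k) t)) +
        compL (nonlinTerm 𝒢 μ ν q k) t + compL (p k) t +
        (compL (opR (q k)) t - compL (X q k) t) := by
    intro k hkN
    have hg := ClassP.sub (ClassP.add (nonlinTerm_mem_classP hmono hpos 𝒢 hν hm k
      fun j _ => hqP j) (hp k)) (hX q k fun j _ => hqP j)
    have h1 := opZ_equation hA (mem_classP_iff.1 hg).1 (lhat (ν k) t (hk k hkN))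
    rw [← hq k] at h1
    simp only [compL_of_lt _ (hk k hkN), Pi.add_apply, Pi.sub_apply] at h1 ⊢
    rw [← sub_eq_iff_eq_add'.2 h1.symm]
    abel
  rw [Finset.sum_congr rfl key]
  simp only [Finset.sum_add_distrib, map_sum, Finset.sum_neg_distrib]
  abel

/-! ### The solution of the differential equation -/

theorem norm_le_of_expansion {G : RVec n → RVec n} {Gm : ℕ → RVec n → RVec n}
    (hGexp : ∀ N : ℕ, 2 ≤ N → ∃ δ : ℝ, 0 < δ ∧
      (fun x => G x - ∑ m ∈ Finset.Icc 2 N, Gm m x) =O[𝓝 0] fun x => ‖x‖ ^ ((N : ℝ) + δ))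
    {M : ℕ} (hM : 2 ≤ M) :
    (fun x => G x - ∑ m ∈ Finset.Icc 2 M, Gm m x) =O[𝓝 0] fun x => ‖x‖ ^ M := by
  obtain ⟨δ, hδ, h⟩ := hGexp M hM
  refine h.trans (IsBigO.of_bound 1 ?_)
  filter_upwards [Metric.ball_mem_nhds (0 : RVec n) one_pos] with x hx
  have hx1 : ‖x‖ < 1 := by simpa using hx
  rw [one_mul, Real.norm_of_nonneg (by positivity), Real.norm_of_nonneg (by positivity),
    ← Real.rpow_natCast]
  rcases (norm_nonneg x).eq_or_lt with h0 | h0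
  · rw [← h0, Real.zero_rpow (by positivity), Real.zero_rpow (by positivity)]
  · exact Real.rpow_le_rpow_of_exponent_ge h0 hx1.le (by linarith)

/-- Since `y → 0` and `G(x) = o(|x|)`, the nonlinearity is eventually an `ε`-small perturbation, so
`y` inherits the rate of `f`. -/
theorem solution_isBigO (hn : 1 ≤ n) {A : Matrix (Fin n) (Fin n) ℝ}
    (hA : ∀ l ∈ spectrum ℂ (A.map (algebraMap ℝ ℂ)), 0 < l.re)
    {G : RVec n → RVec n} {Gm : ℕ → RVec n → RVec n}
    (hGexp : ∀ N : ℕ, 2 ≤ N → ∃ δ : ℝ, 0 < δ ∧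
      (fun x => G x - ∑ m ∈ Finset.Icc 2 N, Gm m x) =O[𝓝 0] fun x => ‖x‖ ^ ((N : ℝ) + δ))
    {𝒢 : (r : ℕ) → MultilinearMap ℝ (fun _ : Fin r => RVec n) (RVec n)}
    (h𝒢 : ∀ r, 2 ≤ r → ∀ x, Gm r x = 𝒢 r fun _ => x)
    {f y : ℝ → RVec n} {T0 : ℝ}
    (hy : ∀ t, T0 < t → HasDerivAt y (-(Matrix.toEuclideanLin A (y t)) + G (y t) + f t) t)
    (hylim : Tendsto y atTop (𝓝 0)) {m : ℕ} {c : ℝ} (hc : 0 < c)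
    (hf : (fun t => toC (f t)) =O[atTop] fun t => iterLog m t ^ (-c)) :
    (fun t => toC (y t)) =O[atTop] fun t => iterLog m t ^ (-c) := by
  obtain ⟨ε, hε, hstab⟩ := exists_stability_iterLog hn _ hA
  refine hstab m c _ (fun t => toC (G (y t)) + toC (f t)) (fun t => ‖toC (f t)‖) hc ?_ ?_
    hf.norm_left
  · filter_upwards [eventually_gt_atTop T0] with t ht
    refine (hy t ht).toC.congr_deriv ?_
    rw [toC_add, toC_add, toC_neg, toC_toEuclideanLin, add_assoc]
  · have hyC : Tendsto (fun t => toC (y t)) atTop (𝓝 0) := by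
      rw [tendsto_zero_iff_norm_tendsto_zero] at hylim ⊢
      simpa only [norm_toC] using hylim
    have h1 := (hyC.prodMk_nhds (tendsto_const_nhds (x := (0 : CVec n)))).eventually
      (polyPart_lipschitz 𝒢 2 (half_pos hε))
    have h2 : (fun x : RVec n => G x - ∑ m ∈ Finset.Icc 2 2, Gm m x) =o[𝓝 0] fun x => x := by
      refine (norm_le_of_expansion hGexp le_rfl).trans_isLittleO ?_
      exact IsLittleO.of_norm_right (isLittleO_norm_pow_id one_lt_two).norm_right
    have h3 := hylim.eventually (h2.bound (half_pos hε))
    filter_upwards [h1, h3] with t h1 h3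
    rw [polyPart_zero, sub_zero, sub_zero] at h1
    rw [← norm_toC, toC_sub, ← polyPart_toC h𝒢, ← norm_toC (y t)] at h3
    have h4 := norm_add_le (toC (G (y t)) - polyPart 𝒢 2 (toC (y t))) (polyPart 𝒢 2 (toC (y t)))
    rw [sub_add_cancel] at h4
    have h5 := norm_add_le (toC (G (y t))) (toC (f t))
    linarith

theorem lExpansion_solution (hn : 1 ≤ n) {A : Matrix (Fin n) (Fin n) ℝ}
    (hA : ∀ l ∈ spectrum ℂ (A.map (algebraMap ℝ ℂ)), 0 < l.re)
    {G : RVec n → RVec n} {Gm : ℕ → RVec n → RVec n}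
    (hGexp : ∀ N : ℕ, 2 ≤ N → ∃ δ : ℝ, 0 < δ ∧
      (fun x => G x - ∑ m ∈ Finset.Icc 2 N, Gm m x) =O[𝓝 0] fun x => ‖x‖ ^ ((N : ℝ) + δ))
    {𝒢 : (r : ℕ) → MultilinearMap ℝ (fun _ : Fin r => RVec n) (RVec n)}
    (h𝒢 : ∀ r, 2 ≤ r → ∀ x, Gm r x = 𝒢 r fun _ => x)
    {f y : ℝ → RVec n} {T0 : ℝ}
    (hy : ∀ t, T0 < t → HasDerivAt y (-(Matrix.toEuclideanLin A (y t)) + G (y t) + f t) t)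
    (hylim : Tendsto y atTop (𝓝 0)) {m : ℕ} {μ : ℕ → ℝ}
    (hmono : StrictMono μ) (hpos : ∀ k, 0 < μ k) {ν : ℕ → ℕ} (hν : Monotone ν)
    (hm : ∀ k, m ≤ ν k) (hadd : ∀ a ∈ range μ, ∀ b ∈ range μ, a + b ∈ range μ)
    {X : ((k : ℕ) → PosVec (ν k) → CVec n) → (k : ℕ) → PosVec (ν k) → CVec n}
    (hX : ∀ q k, (∀ j < k, q j ∈ ClassP n m (ν j) (-μ j)) → X q k ∈ ClassP n m (ν k) (-μ k))
    (hXR : ∀ q, (∀ k, q k ∈ ClassP n m (ν k) (-μ k)) → ∀ N, DecaysBeyond m (μ N) fun t =>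
      ∑ k ∈ Finset.range (N + 1), (compL (opR (q k)) t - compL (X q k) t))
    {p q : (k : ℕ) → PosVec (ν k) → CVec n} (hp : ∀ k, p k ∈ ClassP n m (ν k) (-μ k))
    (hf : LExpansion m μ (fun t => toC (f t)) fun k => compL (p k))
    (hq : ∀ k, q k = opZ (A.map (algebraMap ℝ ℂ)) (nonlinTerm 𝒢 μ ν q k + p k - X q k)) :
    LExpansion m μ (fun t => toC (y t)) fun k => compL (q k) := by
  have hqP := formal_solution_mem_classP hmono hpos hν hm hX 𝒢 hp hq
  -- Any rate below `μ 0` would do; `μ 0` itself may fail because of logarithmic factors.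
  have hsmall : ∀ {p : (k : ℕ) → PosVec (ν k) → CVec n},
      (∀ k, p k ∈ ClassP n m (ν k) (-μ k)) → ∀ k,
        compL (p k) =O[atTop] fun t => iterLog m t ^ (-(μ 0 / 2)) := fun hp k =>
    compL_isBigO (hm k) (by linarith [hmono.monotone (Nat.zero_le k), hpos 0])
      (mem_classP_iff.1 (hp k)).1
  have hc : 0 < μ 0 / 2 := half_pos (hpos 0)
  have hfO : (fun t => toC (f t)) =O[atTop] fun t => iterLog m t ^ (-(μ 0 / 2)) := by
    obtain ⟨κ, h1, h2⟩ := hf 0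
    have h3 := (h2.trans (iterLog_rpow_isBigO m (y := -(μ 0 / 2))
      (by linarith [hpos 0]))).add (hsmall hp 0)
    refine h3.congr_left fun t => ?_
    simp
  have hyO := solution_isBigO hn hA hGexp h𝒢 hy hylim hc hfO
  intro N
  obtain ⟨M, hM2, hM⟩ := exists_nat_mul_ge hpos (N + 1)
  -- The degree is `2 * M` because `y` is only known to have the rate `μ 0 / 2`: then `|y|^{2M}` has
  -- the rate `M μ 0`, which is at least `μ (N + 1)`.
  obtain ⟨ρ, ⟨κ, hκ, hρ⟩, hs⟩ := exists_residual hA hmono hpos hν hm hadd hX hXR 𝒢 hp hf hq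
    (M := 2 * M) (N := N) (by
      push_cast
      nlinarith [hmono.monotone (Nat.le_succ N), hpos (N + 1)])
  obtain ⟨ε, hε, hstab⟩ := exists_stability_iterLog hn _ hA
  set s : ℝ → CVec n := fun t => ∑ k ∈ Finset.range (N + 1), compL (q k) t with hsdef
  have hsO : s =O[atTop] fun t => iterLog m t ^ (-(μ 0 / 2)) :=
    IsBigO.fun_sum fun k _ => hsmall hqP k
  have hlim := tendsto_iterLog_rpow_neg m hc
  have hlip := ((hyO.trans_tendsto hlim).prodMk_nhds (hsO.trans_tendsto hlim)).eventually
    (polyPart_lipschitz 𝒢 (2 * M) hε)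
  have hrem : (fun t => toC (G (y t)) - polyPart 𝒢 (2 * M) (toC (y t))) =O[atTop]
      fun t => iterLog m t ^ (-μ (N + 1)) := by
    have h1 := (norm_le_of_expansion hGexp (M := 2 * M) (by omega)).comp_tendsto hylim
    have h2 : (fun t => ‖y t‖ ^ (2 * M)) =O[atTop]
        fun t => (iterLog m t ^ (-(μ 0 / 2))) ^ (2 * M) := by
      refine IsBigO.pow ?_ _
      simpa only [← norm_toC] using hyO.norm_left
    have h3 : (fun t => (iterLog m t ^ (-(μ 0 / 2))) ^ (2 * M)) =O[atTop]
        fun t => iterLog m t ^ (-μ (N + 1)) := by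
      refine (iterLog_rpow_isBigO m (x := -(M * μ 0)) (neg_le_neg hM)).congr' ?_ .rfl
      filter_upwards [eventually_iterLog_pos m] with t ht
      rw [← Real.rpow_natCast, ← Real.rpow_mul ht.le]
      congr 1
      push_cast
      ring
    refine IsBigO.of_norm_left ?_
    have h4 := (h1.trans (h2.trans h3)).norm_left
    refine h4.congr_left fun t => ?_
    rw [Function.comp_apply, ← norm_toC, toC_sub, polyPart_toC h𝒢]
  -- The residual limits the rate to `κ`, the Taylor remainder of `G` to `μ (N + 1)`; both exceed `μ
  -- N`.
  refine ⟨min κ (μ (N + 1)), lt_min hκ (hmono (Nat.lt_succ_self N)), ?_⟩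
  refine hstab m _ (fun t => toC (y t) - s t)
    (fun t => toC (G (y t)) - polyPart 𝒢 (2 * M) (s t) - ρ t)
    (fun t => ‖toC (G (y t)) - polyPart 𝒢 (2 * M) (toC (y t))‖ + ‖ρ t‖)
    (lt_min ((hpos N).trans hκ) (hpos _)) ?_ ?_ ?_
  · filter_upwards [eventually_gt_atTop T0, hs] with t ht hst
    refine ((hy t ht).toC.sub hst).congr_deriv ?_
    rw [toC_add, toC_add, toC_neg, toC_toEuclideanLin, map_sub]
    abel
  · filter_upwards [hlip] with t ht
    have h1 : toC (G (y t)) - polyPart 𝒢 (2 * M) (s t) - ρ t =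
        (toC (G (y t)) - polyPart 𝒢 (2 * M) (toC (y t))) +
        (polyPart 𝒢 (2 * M) (toC (y t)) - polyPart 𝒢 (2 * M) (s t)) - ρ t := by abel
    rw [h1]
    have h2 := norm_sub_le ((toC (G (y t)) - polyPart 𝒢 (2 * M) (toC (y t))) +
        (polyPart 𝒢 (2 * M) (toC (y t)) - polyPart 𝒢 (2 * M) (s t))) (ρ t)
    have h3 := norm_add_le (toC (G (y t)) - polyPart 𝒢 (2 * M) (toC (y t)))
        (polyPart 𝒢 (2 * M) (toC (y t)) - polyPart 𝒢 (2 * M) (s t))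
    linarith
  · exact (hrem.norm_left.trans (iterLog_rpow_isBigO m (neg_le_neg (min_le_right _ _)))).add
      (hρ.norm_left.trans (iterLog_rpow_isBigO m (neg_le_neg (min_le_left _ _))))

end FormalSolutions

/-! ### Assembly of the recursion and the expansion. -/

theorem LExpansion.congr_compL {n m : ℕ} {μ : ℕ → ℝ} {ν : ℕ → ℕ} {g : ℝ → CVec n}
    {gk : ℕ → ℝ → CVec n} {p : (k : ℕ) → PosVec (ν k) → CVec n} (h : LExpansion m μ g gk)
    (hp : ∀ k, EqOn (gk k) (compL (p k)) (Ioi (iterExp (ν k) 0))) :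
    LExpansion m μ g fun k => compL (p k) := by
  intro N
  refine DecaysBeyond.congr (h N) ?_
  have : ∀ᶠ t in atTop, ∀ k ∈ Finset.range (N + 1), iterExp (ν k) 0 < t :=
    (Finset.eventually_all _).2 fun k _ => eventually_gt_atTop _
  filter_upwards [this] with t ht
  rw [Finset.sum_congr rfl fun k hk => hp k (ht k hk)]

/-- The expansion of the solution, with a general correction term `X` in the recursion. -/
theorem expansion_of_recursion {n : ℕ} (hn : 1 ≤ n) {A : Matrix (Fin n) (Fin n) ℝ}
    (hA : ∀ l ∈ spectrum ℂ (A.map (algebraMap ℝ ℂ)), 0 < l.re)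
    {G : RVec n → RVec n} {Gm : ℕ → RVec n → RVec n}
    (hGm : ∀ m, 2 ≤ m → IsHomogPolyMap m (Gm m))
    (hGexp : ∀ N : ℕ, 2 ≤ N → ∃ δ : ℝ, 0 < δ ∧
      (fun x => G x - ∑ m ∈ Finset.Icc 2 N, Gm m x) =O[𝓝 0] fun x => ‖x‖ ^ ((N : ℝ) + δ))
    {f y : ℝ → RVec n} {T0 : ℝ}
    (hy : ∀ t, T0 < t → HasDerivAt y (-(Matrix.toEuclideanLin A (y t)) + G (y t) + f t) t)
    (hylim : Tendsto y atTop (𝓝 0)) {m : ℕ} {μ : ℕ → ℝ}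
    (hmono : StrictMono μ) (hpos : ∀ k, 0 < μ k) {ν : ℕ → ℕ} (hν : Monotone ν)
    (hm : ∀ k, m ≤ ν k) (hadd : ∀ a ∈ range μ, ∀ b ∈ range μ, a + b ∈ range μ)
    {X : ((k : ℕ) → PosVec (ν k) → CVec n) → (k : ℕ) → PosVec (ν k) → CVec n}
    (hXc : ∀ k q q', (∀ j < k, q j = q' j) → X q k = X q' k)
    (hX : ∀ q k, (∀ j < k, q j ∈ ClassP n m (ν j) (-μ j)) → X q k ∈ ClassP n m (ν k) (-μ k))
    (hXR : ∀ q, (∀ k, q k ∈ ClassP n m (ν k) (-μ k)) → ∀ N, DecaysBeyond m (μ N) fun t =>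
      ∑ k ∈ Finset.range (N + 1), (compL (opR (q k)) t - compL (X q k) t))
    {fk : ℕ → ℝ → CVec n} (hfk : ∀ k, fk k ∈ ClassF n m (ν k) (-μ k))
    (hf : LExpansion m μ (fun t => toC (f t)) fk) :
    (∃ yk : ℕ → ℝ → CVec n,
      (∀ k, yk k ∈ ClassF n m (ν k) (-μ k)) ∧
      (∀ k t, iterExp (ν k) 0 < t → IsRealVec (yk k t)) ∧
      LExpansion m μ (fun t => toC (y t)) yk) ∧
    ∀ 𝒢 : (r : ℕ) → MultilinearMap ℝ (fun _ : Fin r => RVec n) (RVec n),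
      (∀ r, 2 ≤ r → ∀ x, Gm r x = 𝒢 r fun _ => x) →
      ∀ p : (k : ℕ) → PosVec (ν k) → CVec n,
        (∀ k, p k ∈ ClassP n m (ν k) (-μ k)) →
        (∀ k, EqOn (fk k) (compL (p k)) (Ioi (iterExp (ν k) 0))) →
        (∃! q : (k : ℕ) → PosVec (ν k) → CVec n, ∀ k,
          q k = opZ (A.map (algebraMap ℝ ℂ)) (nonlinTerm 𝒢 μ ν q k + p k - X q k)) ∧
        ∀ q : (k : ℕ) → PosVec (ν k) → CVec n,
          (∀ k, q k = opZ (A.map (algebraMap ℝ ℂ)) (nonlinTerm 𝒢 μ ν q k + p k - X q k)) →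
          (∀ k, q k ∈ ClassP n m (ν k) (-μ k)) ∧ (∀ k z, IsRealVec (q k z)) ∧
          LExpansion m μ (fun t => toC (y t)) fun k => compL (q k) := by
  have hunique : ∀ (𝒢 : (r : ℕ) → MultilinearMap ℝ (fun _ : Fin r => RVec n) (RVec n))
      (p : (k : ℕ) → PosVec (ν k) → CVec n), ∃! q : (k : ℕ) → PosVec (ν k) → CVec n, ∀ k,
        q k = opZ (A.map (algebraMap ℝ ℂ)) (nonlinTerm 𝒢 μ ν q k + p k - X q k) := fun 𝒢 p =>
    existsUnique_of_causal (fun q k =>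
      opZ (A.map (algebraMap ℝ ℂ)) (nonlinTerm 𝒢 μ ν q k + p k - X q k)) fun k q q' h => by
        simp only [nonlinTerm_congr hmono hpos 𝒢 ν k q q' h, hXc k q q' h]
  have hmain : ∀ 𝒢 : (r : ℕ) → MultilinearMap ℝ (fun _ : Fin r => RVec n) (RVec n),
      (∀ r, 2 ≤ r → ∀ x, Gm r x = 𝒢 r fun _ => x) →
      ∀ p : (k : ℕ) → PosVec (ν k) → CVec n, (∀ k, p k ∈ ClassP n m (ν k) (-μ k)) →
        (∀ k, EqOn (fk k) (compL (p k)) (Ioi (iterExp (ν k) 0))) →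
        ∀ q : (k : ℕ) → PosVec (ν k) → CVec n,
          (∀ k, q k = opZ (A.map (algebraMap ℝ ℂ)) (nonlinTerm 𝒢 μ ν q k + p k - X q k)) →
          (∀ k, q k ∈ ClassP n m (ν k) (-μ k)) ∧ (∀ k z, IsRealVec (q k z)) ∧
          LExpansion m μ (fun t => toC (y t)) fun k => compL (q k) := by
    intro 𝒢 h𝒢 p hp hfp q hq
    have hqP := formal_solution_mem_classP hmono hpos hν hm hX 𝒢 hp hq
    exact ⟨hqP, fun k => (mem_classP_iff.1 (hqP k)).2,
      lExpansion_solution hn hA hGexp h𝒢 hy hylim hmono hpos hν hm hadd hX hXR hp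
        (hf.congr_compL hfp) hq⟩
  refine ⟨?_, fun 𝒢 h𝒢 p hp hfp => ⟨hunique 𝒢 p, hmain 𝒢 h𝒢 p hp hfp⟩⟩
  have h𝒢 : ∀ r, ∃ M : MultilinearMap ℝ (fun _ : Fin r => RVec n) (RVec n),
      2 ≤ r → ∀ x, Gm r x = M fun _ => x := by
    intro r
    by_cases hr : 2 ≤ r
    · obtain ⟨M, hM⟩ := (hGm r hr).exists_multilinear
      exact ⟨M, fun _ => hM⟩
    · exact ⟨0, fun h => absurd h hr⟩
  choose 𝒢 h𝒢 using h𝒢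
  choose p hp hfp using hfk
  obtain ⟨q, hq, -⟩ := hunique 𝒢 p
  obtain ⟨h1, h2, h3⟩ := hmain 𝒢 h𝒢 p hp hfp q hq
  refine ⟨fun k => compL (q k), fun k => ⟨q k, h1 k, fun _ _ => rfl⟩, fun k t ht => ?_, h3⟩
  change IsRealVec (compL (q k) t)
  rw [compL_of_lt _ ht]
  exact h2 k _

theorem theorem10p9 (n : ℕ) (hn : 1 ≤ n)
    -- the matrix
    (A : Matrix (Fin n) (Fin n) ℝ)
    (hA : ∀ l ∈ spectrum ℂ (A.map (algebraMap ℝ ℂ)), 0 < l.re)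
    -- the nonlinearity
    (G : RVec n → RVec n) (hG : LocallyLipschitz G)
    (Gm : ℕ → RVec n → RVec n) (hGm : ∀ m, 2 ≤ m → IsHomogPolyMap m (Gm m))
    (hGexp : ∀ N : ℕ, 2 ≤ N → ∃ δ : ℝ, 0 < δ ∧
      (fun x => G x - ∑ m ∈ Finset.Icc 2 N, Gm m x) =O[𝓝 0] fun x => ‖x‖ ^ ((N : ℝ) + δ))
    -- the forcing function
    (f : ℝ → RVec n) (Tf : ℝ) (hTf : 0 ≤ Tf) (hf : ContinuousOn f (Ici Tf))
    -- the decaying solution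
    (y : ℝ → RVec n) (T0 : ℝ) (hT0 : 0 ≤ T0) (hyC1 : ContDiffOn ℝ 1 y (Ioi T0))
    (hy : ∀ t, T0 < t → HasDerivAt y (-(Matrix.toEuclideanLin A (y t)) + G (y t) + f t) t)
    (hylim : Tendsto y atTop (𝓝 0)) :
    -- power decay
    (∀ (μ : ℕ → ℝ) (ν : ℕ → ℕ) (fk : ℕ → ℝ → CVec n),
      StrictMono μ → (∀ k, 0 < μ k) → Tendsto μ atTop atTop → Monotone ν →
      (∀ a ∈ range μ, ∀ b ∈ range μ, a + b ∈ range μ) → (∀ a ∈ range μ, a + 1 ∈ range μ) →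
      (∀ k, fk k ∈ ClassF n 0 (ν k) (-μ k)) →
      LExpansion 0 μ (fun t => toC (f t)) fk →
      (∃ yk : ℕ → ℝ → CVec n,
        (∀ k, yk k ∈ ClassF n 0 (ν k) (-μ k)) ∧
        (∀ k t, iterExp (ν k) 0 < t → IsRealVec (yk k t)) ∧
        LExpansion 0 μ (fun t => toC (y t)) yk) ∧
      ∀ 𝒢 : (r : ℕ) → MultilinearMap ℝ (fun _ : Fin r => RVec n) (RVec n),
        (∀ r, 2 ≤ r → ∀ x, Gm r x = 𝒢 r fun _ => x) →
        ∀ p : (k : ℕ) → PosVec (ν k) → CVec n,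
          (∀ k, p k ∈ ClassP n 0 (ν k) (-μ k)) →
          (∀ k, EqOn (fk k) (compL (p k)) (Ioi (iterExp (ν k) 0))) →
          (∃! q : (k : ℕ) → PosVec (ν k) → CVec n, ∀ k,
            q k = opZ (A.map (algebraMap ℝ ℂ)) (nonlinTerm 𝒢 μ ν q k + p k - chiTerm μ ν q k)) ∧
          ∀ q : (k : ℕ) → PosVec (ν k) → CVec n,
            (∀ k, q k =
              opZ (A.map (algebraMap ℝ ℂ)) (nonlinTerm 𝒢 μ ν q k + p k - chiTerm μ ν q k)) →
            (∀ k, q k ∈ ClassP n 0 (ν k) (-μ k)) ∧ (∀ k z, IsRealVec (q k z)) ∧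
            LExpansion 0 μ (fun t => toC (y t)) fun k => compL (q k)) ∧
    -- logarithmic and iterated logarithmic decay
    (∀ (m : ℕ) (μ : ℕ → ℝ) (ν : ℕ → ℕ) (fk : ℕ → ℝ → CVec n),
      1 ≤ m → StrictMono μ → (∀ k, 0 < μ k) → Tendsto μ atTop atTop →
      Monotone ν → (∀ k, m ≤ ν k) →
      (∀ a ∈ range μ, ∀ b ∈ range μ, a + b ∈ range μ) →
      (∀ k, fk k ∈ ClassF n m (ν k) (-μ k)) →
      LExpansion m μ (fun t => toC (f t)) fk →
      (∃ yk : ℕ → ℝ → CVec n,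
        (∀ k, yk k ∈ ClassF n m (ν k) (-μ k)) ∧
        (∀ k t, iterExp (ν k) 0 < t → IsRealVec (yk k t)) ∧
        LExpansion m μ (fun t => toC (y t)) yk) ∧
      ∀ 𝒢 : (r : ℕ) → MultilinearMap ℝ (fun _ : Fin r => RVec n) (RVec n),
        (∀ r, 2 ≤ r → ∀ x, Gm r x = 𝒢 r fun _ => x) →
        ∀ p : (k : ℕ) → PosVec (ν k) → CVec n,
          (∀ k, p k ∈ ClassP n m (ν k) (-μ k)) →
          (∀ k, EqOn (fk k) (compL (p k)) (Ioi (iterExp (ν k) 0))) →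
          (∃! q : (k : ℕ) → PosVec (ν k) → CVec n, ∀ k,
            q k = opZ (A.map (algebraMap ℝ ℂ)) (nonlinTerm 𝒢 μ ν q k + p k)) ∧
          ∀ q : (k : ℕ) → PosVec (ν k) → CVec n,
            (∀ k, q k = opZ (A.map (algebraMap ℝ ℂ)) (nonlinTerm 𝒢 μ ν q k + p k)) →
            (∀ k, q k ∈ ClassP n m (ν k) (-μ k)) ∧ (∀ k z, IsRealVec (q k z)) ∧
            LExpansion m μ (fun t => toC (y t)) fun k => compL (q k)) := by
  constructor
  · intro μ ν fk hmono hpos _ hν hadd hone hfk hfexp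
    exact expansion_of_recursion hn hA hGm hGexp hy hylim hmono hpos hν
      (fun _ => Nat.zero_le _) hadd (X := chiTerm μ ν) chiTerm_congr
      (fun _ k => chiTerm_mem_classP hmono hν k)
      (fun _ => decaysBeyond_opR_sub_chiTerm hmono hν hone) hfk hfexp
  · intro m μ ν fk hm hmono hpos _ hν hmν hadd hfk hfexp
    -- With `X = 0` all of `ℛ q_k` goes into the remainder, which is harmless because `m ≥ 1`.
    have h := expansion_of_recursion hn hA hGm hGexp hy hylim hmono hpos hν hmν hadd
      (X := fun _ _ => 0) (fun _ _ _ _ => rfl) (fun _ _ _ => ClassP.zero)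
      (fun q hq N => DecaysBeyond.sum fun k _ => by
        refine (decaysBeyond_opR hm (mem_classP_iff.1 (hq k)).1).congr ?_
        filter_upwards [eventually_gt_atTop (iterExp (ν k) 0)] with t ht
        rw [compL_of_lt 0 ht, Pi.zero_apply, sub_zero]) hfk hfexp
    simpa only [sub_zero] using h
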